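/- For $N \ge 1$, consider $N$ blue and $N$ red points on an interval $[0,L]$. An instance is described by a pair $[\vec s,\sigma]$. Here $\vec s=(s_0,\dots,s_{2N})$ is the vector of the spacings: the points in increasing order are $z_i=s_0+\dots+s_{i-1}$ for $1\le i\le 2N$, and $L=s_0+\dots+s_{2N}$. The vector $\sigma\in\{-1,+1\}^{2N}$, with $\sum_i\sigma_i=0$, gives the colours of the points in increasing order ($+1$ is blue, $-1$ is red). The colour sequence $\sigma$ is uniformly distributed on the $\binom{2N}{N}$ such sequences and independent of $\vec s$, and the law of $\vec s$ is one of the following. - Exponential spacings (ES): the $s_i$ are i.i.d. exponential variables of mean $1$. - Uniform spacings (US): all $s_i$ are equal to $1$. - Poisson point process (PPP): the $s_i$ are the spacings in the sorted list of $0$, $2N+1$ and $2N$ independent uniform random points of $[0,2N+1]$. View $\sigma$ as a lattice bridge with heights $h_m=\sigma_1+\dots+\sigma_m$, $0\le m\le 2N$. The Dyck matching is the canonical pairing of up and down steps within every excursion of the bridge away from $0$: each step $i$ that moves away from $0$ (i.e. $|h_i|>|h_{i-1}|$) is paired with the first later step $j$ such that $h_j=h_{i-1}$. This gives a perfect matching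 of the blue with the red points. For $0\le p\le 1$ let $H_{\rm Dyck}$ be its cost, the sum of $|x-y|^p$ over all pairs consisting of a blue point $x$ and a red point $y$ that are matched, and let $\mathbb E_N(H_{\rm Dyck})$ be its expectation over $\sigma$ and $\vec s$. **Theorem.** For each of the three models ES, US and PPP, $\mathbb E_N(H_{\rm Dyck})$ is finite for every $N$, and $$\mathbb E_N(H_{\rm Dyck})\simeq\begin{cases} N & \text{if } 0\le p<\tfrac12,\\ N\ln N & \text{if } p=\tfrac12,\\ N^{\frac12+p} & \text{if } \tfrac12<p\le 1,\end{cases}$$ where $a(N)\simeq b(N)$ means that $a(N)/b(N)$ tends to a finite nonzero constant as $N\to\infty$ (the constant may depend on $p$ and on the model). -/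

import Mathlib

open MeasureTheory ProbabilityTheory Filter Topology

namespace DyckAssignment

/-! ### Colour sequences and the associated lattice bridge -/

/-- Colour sequences of `N` blue (`+1`) and `N` red (`-1`) points, i.e. Dyck bridges of
semi-length `N`. -/
abbrev Bridge (N : ℕ) : Type :=
  {σ : Fin (2 * N) → ℤˣ // ∑ i, (σ i : ℤ) = 0}

/-- Indices of the blue points (up steps). -/
abbrev Blue {N : ℕ} (σ : Bridge N) : Type := {i : Fin (2 * N) // σ.1 i = 1}

/-- Indices of the red points (down steps). -/
abbrev Red {N : ℕ} (σ : Bridge N) : Type := {i : Fin (2 * N) // σ.1 i = -1}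

/-- Height of the bridge after its first `m` steps. -/
def height {N : ℕ} (σ : Bridge N) (m : ℕ) : ℤ :=
  ∑ i : Fin (2 * N) with i.val < m, (σ.1 i : ℤ)

/-- Steps `i` and `j` are the opening and the closing step of an arc: step `i` moves away from the
horizontal axis, and step `j` is the step of the first return to the level from which
step `i` started. (In an excursion above the axis `i` is an up step, below it a down step.) -/
def IsArc {N : ℕ} (σ : Bridge N) (i j : Fin (2 * N)) : Prop :=
  i < j ∧ |height σ i| < |height σ (i + 1)| ∧ height σ (j + 1) = height σ i ∧
    ∀ m : ℕ, i.val < m → m ≤ j.val → height σ m ≠ height σ i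

/-- Two steps are paired if they are, in one of the two orders, the ends of an arc. -/
def Paired {N : ℕ} (σ : Bridge N) (i j : Fin (2 * N)) : Prop :=
  IsArc σ i j ∨ IsArc σ j i

section Pairing

variable {N : ℕ} (σ : Bridge N)

lemma height_zero : height σ 0 = 0 := by simp [height]

lemma height_end : height σ (2 * N) = 0 := by
  have h : (Finset.univ.filter fun i : Fin (2 * N) => i.val < 2 * N) = Finset.univ :=
    Finset.filter_true_of_mem fun i _ => i.2
  rw [height, h, σ.2]

lemma height_succ (i : Fin (2 * N)) : height σ (i + 1) = height σ i + (σ.1 i : ℤ) := by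
  have h : (Finset.univ.filter fun j : Fin (2 * N) => j.val < i.val + 1)
      = insert i (Finset.univ.filter fun j : Fin (2 * N) => j.val < i.val) := by
    ext j
    simp only [Finset.mem_filter, Finset.mem_univ, true_and, Finset.mem_insert, Fin.ext_iff]
    omega
  rw [height, h, Finset.sum_insert (by simp), height, add_comm]

lemma height_step (m : ℕ) (hm : m < 2 * N) :
    height σ (m + 1) = height σ m + 1 ∨ height σ (m + 1) = height σ m - 1 := by
  have h := height_succ σ ⟨m, hm⟩
  rcases Int.units_eq_one_or (σ.1 ⟨m, hm⟩) with h1 | h1 <;> rw [h1] at h <;> simp at h <;> omega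

lemma open_iff (i : Fin (2 * N)) :
    |height σ i| < |height σ (i + 1)| ↔ 0 ≤ (σ.1 i : ℤ) * height σ i := by
  rw [height_succ]
  rcases Int.units_eq_one_or (σ.1 i) with h1 | h1 <;> rw [h1] <;> simp <;> grind

/-- The walk seen from a level `c` and oriented by a sign `e` changes by one in every step. -/
lemma oriented_step (e : ℤˣ) (c : ℤ) (m : ℕ) (hm : m < 2 * N) :
    (e : ℤ) * (height σ (m + 1) - c) ≤ (e : ℤ) * (height σ m - c) + 1 ∧
      (e : ℤ) * (height σ m - c) - 1 ≤ (e : ℤ) * (height σ (m + 1) - c) := by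
  have h := height_step σ m hm
  rcases Int.units_eq_one_or e with h1 | h1 <;> rw [h1] <;> simp <;> omega

/-- Along an arc the walk stays strictly beyond its initial level. -/
lemma arc_pos {i j : Fin (2 * N)} (h : IsArc σ i j) (m : ℕ) (h1 : i.val < m) (h2 : m ≤ j.val) :
    1 ≤ (σ.1 i : ℤ) * (height σ m - height σ i) := by
  obtain ⟨hij, ho, hc, hb⟩ := h
  induction m, h1 using Nat.le_induction with
  | base =>
    have := height_succ σ i
    rw [Nat.succ_eq_add_one, this]
    rcases Int.units_eq_one_or (σ.1 i) with h1 | h1 <;> rw [h1] <;> simp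
  | succ n hn ih =>
    have h3 := ih (by omega)
    have h4 := oriented_step σ (σ.1 i) (height σ i) n (by omega)
    have h5 := hb (n + 1) (by omega) h2
    rcases Int.units_eq_one_or (σ.1 i) with h1 | h1 <;> rw [h1] at h3 h4 ⊢ <;>
      simp at h3 h4 ⊢ <;> omega

lemma arc_sign {i j : Fin (2 * N)} (h : IsArc σ i j) : σ.1 j = -σ.1 i := by
  have h1 := arc_pos σ h j h.1 le_rfl
  have h2 := height_succ σ j
  rw [h.2.2.1] at h2
  rcases Int.units_eq_one_or (σ.1 i) with h3 | h3 <;>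
    rcases Int.units_eq_one_or (σ.1 j) with h4 | h4 <;> rw [h3, h4] <;> rw [h3] at h1 <;>
    rw [h4] at h2 <;> simp at h1 h2 ⊢ <;> omega

lemma arc_close {i j : Fin (2 * N)} (h : IsArc σ i j) : (σ.1 j : ℤ) * height σ j < 0 := by
  have h1 := height_succ σ j
  have h2 := (open_iff σ i).1 h.2.1
  have h3 := arc_sign σ h
  rw [h.2.2.1] at h1
  rcases Int.units_eq_one_or (σ.1 i) with h4 | h4 <;> rw [h4] at h2 h3 <;> rw [h3] at h1 ⊢ <;>
    simp at h1 h2 ⊢ <;> omega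

lemma exists_arc_of_open (i : Fin (2 * N)) (hi : 0 ≤ (σ.1 i : ℤ) * height σ i) :
    ∃ j, IsArc σ i j := by
  classical
  have hstart : (σ.1 i : ℤ) * (height σ (i + 1) - height σ i) = 1 := by
    rw [height_succ]
    rcases Int.units_eq_one_or (σ.1 i) with h1 | h1 <;> rw [h1] <;> simp
  have hex : ∃ m, i.val < m ∧ m ≤ 2 * N ∧ (σ.1 i : ℤ) * (height σ m - height σ i) ≤ 0 :=
    ⟨2 * N, i.2, le_rfl, by rw [height_end]; linarith⟩
  obtain ⟨k1, k2, k3⟩ := Nat.find_spec hex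
  have hmin := fun m => Nat.find_min hex (m := m)
  set k := Nat.find hex
  have hk : i.val + 1 < k := by
    rcases Nat.lt_or_ge (i.val + 1) k with h | h
    · exact h
    · have : k = i.val + 1 := by omega
      rw [this] at k3
      omega
  have hbig : ∀ m, i.val < m → m < k →
      0 < (σ.1 i : ℤ) * (height σ m - height σ i) := by
    intro m h1 h2
    by_contra h3
    exact hmin m h2 ⟨h1, by omega, by omega⟩
  refine ⟨⟨k - 1, by omega⟩, ?_, (open_iff σ i).2 hi, ?_, ?_⟩
  · rw [Fin.lt_def]
    simp only
    omega
  · have h1 := hbig (k - 1) (by omega) (by omega)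
    have h2 := oriented_step σ (σ.1 i) (height σ i) (k - 1) (by omega)
    simp only
    rw [Nat.sub_add_cancel (by omega)] at h2 ⊢
    have h0 : (σ.1 i : ℤ) * (height σ k - height σ i) = 0 := by omega
    rcases mul_eq_zero.1 h0 with h | h
    · exact absurd h (σ.1 i).ne_zero
    · omega
  · intro m h1 h2 h3
    have := hbig m h1 (by simp only at h2; omega)
    rw [h3] at this
    simp at this

lemma exists_arc_of_close (j : Fin (2 * N)) (hj : (σ.1 j : ℤ) * height σ j < 0) :
    ∃ i, IsArc σ i j := by
  classical
  have hs := height_succ σ j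
  have hsq : (σ.1 j : ℤ) * (σ.1 j : ℤ) = 1 := by
    rcases Int.units_eq_one_or (σ.1 j) with h1 | h1 <;> rw [h1] <;> simp
  have hend : ((-σ.1 j : ℤˣ) : ℤ) * (height σ j - height σ (j + 1)) = 1 := by
    rw [hs]; push_cast; linarith
  set P : ℕ → Prop := fun m =>
    ((-σ.1 j : ℤˣ) : ℤ) * (height σ m - height σ (j + 1)) ≤ 0 with hP
  have hP0 : P 0 := by
    simp only [hP]
    rw [height_zero, hs]; push_cast; linarith
  have k1 : Nat.findGreatest P j.val ≤ j.val := Nat.findGreatest_le _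
  have k2 : P (Nat.findGreatest P j.val) := Nat.findGreatest_spec (Nat.zero_le _) hP0
  have k3 : ∀ m, Nat.findGreatest P j.val < m → m ≤ j.val → ¬ P m :=
    fun m h1 h2 => Nat.findGreatest_is_greatest h1 h2
  set k := Nat.findGreatest P j.val
  have hk : k < j.val := by
    rcases Nat.lt_or_ge k j.val with h | h
    · exact h
    · have : k = j.val := by omega
      rw [this] at k2
      simp only [hP] at k2
      omega
  have h1 := k3 (k + 1) (by omega) (by omega)
  simp only [hP] at h1 k2
  have h2 := oriented_step σ (-σ.1 j) (height σ (j + 1)) k (by omega)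
  have h0 : ((-σ.1 j : ℤˣ) : ℤ) * (height σ k - height σ (j + 1)) = 0 := by omega
  have hlev : height σ k = height σ (j + 1) := by
    rcases mul_eq_zero.1 h0 with h | h
    · exact absurd h (-σ.1 j).ne_zero
    · omega
  have hone : ((-σ.1 j : ℤˣ) : ℤ) * (height σ (k + 1) - height σ (j + 1)) = 1 := by omega
  have hsign : σ.1 ⟨k, by omega⟩ = -σ.1 j := by
    have h3 := height_succ σ ⟨k, by omega⟩
    simp only at h3
    rw [h3, hlev] at hone
    rcases Int.units_eq_one_or (σ.1 ⟨k, by omega⟩) with h4 | h4 <;>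
      rcases Int.units_eq_one_or (σ.1 j) with h5 | h5 <;> rw [h4, h5] at hone ⊢ <;> simp at hone ⊢
  refine ⟨⟨k, by omega⟩, by rw [Fin.lt_def]; exact hk, ?_, hlev.symm, ?_⟩
  · rw [open_iff, hsign]
    simp only
    rw [hlev, hs]; push_cast; linarith
  · intro m h3 h4 h5
    refine k3 m h3 h4 ?_
    simp only [hP]
    simp only at h5
    rw [h5, hlev]
    simp

lemma arc_right_unique {i j j' : Fin (2 * N)} (h : IsArc σ i j) (h' : IsArc σ i j') : j = j' := by
  rcases lt_trichotomy j j' with hlt | heq | hgt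
  · exact absurd h.2.2.1 (h'.2.2.2 _ (by have := h.1; rw [Fin.lt_def] at this; omega) hlt)
  · exact heq
  · exact absurd h'.2.2.1 (h.2.2.2 _ (by have := h'.1; rw [Fin.lt_def] at this; omega) hgt)

lemma arc_left_unique {i i' j : Fin (2 * N)} (h : IsArc σ i j) (h' : IsArc σ i' j) : i = i' := by
  have hl : height σ i = height σ i' := h.2.2.1.symm.trans h'.2.2.1
  rcases lt_trichotomy i i' with hlt | heq | hgt
  · exact absurd hl.symm (h.2.2.2 _ hlt h'.1.le)
  · exact heq
  · exact absurd hl (h'.2.2.2 _ hgt h.1.le)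

lemma paired_comm {i j : Fin (2 * N)} : Paired σ i j ↔ Paired σ j i := or_comm

lemma paired_sign {i j : Fin (2 * N)} (h : Paired σ i j) : σ.1 j = -σ.1 i := by
  rcases h with h | h
  · exact arc_sign σ h
  · rw [arc_sign σ h, neg_neg]

/-- Every step is paired with exactly one other step. -/
lemma existsUnique_paired (i : Fin (2 * N)) : ∃! j, Paired σ i j := by
  rcases le_or_gt 0 ((σ.1 i : ℤ) * height σ i) with hi | hi
  · obtain ⟨j, hj⟩ := exists_arc_of_open σ i hi
    refine ⟨j, Or.inl hj, fun j' hj' => ?_⟩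
    rcases hj' with h | h
    · exact arc_right_unique σ h hj
    · exact absurd (arc_close σ h) (not_lt.2 hi)
  · obtain ⟨j, hj⟩ := exists_arc_of_close σ i hi
    refine ⟨j, Or.inr hj, fun j' hj' => ?_⟩
    rcases hj' with h | h
    · exact absurd ((open_iff σ i).1 h.2.1) (not_le.2 hi)
    · exact arc_left_unique σ h hj

end Pairing

/-- The Dyck matching: the canonical pairing of up and down steps within every excursion of the
bridge, as a bijection from the blue points to the red points. -/
noncomputable def dyckMatching {N : ℕ} (σ : Bridge N) : Blue σ ≃ Red σ where
  toFun b := ⟨(existsUnique_paired σ b.1).choose, by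
    rw [paired_sign σ (existsUnique_paired σ b.1).choose_spec.1, b.2]⟩
  invFun r := ⟨(existsUnique_paired σ r.1).choose, by
    rw [paired_sign σ (existsUnique_paired σ r.1).choose_spec.1, r.2, neg_neg]⟩
  left_inv b := Subtype.ext <| (existsUnique_paired σ _).unique
    (existsUnique_paired σ _).choose_spec.1
    ((paired_comm σ).1 (existsUnique_paired σ b.1).choose_spec.1)
  right_inv r := Subtype.ext <| (existsUnique_paired σ _).unique
    (existsUnique_paired σ _).choose_spec.1
    ((paired_comm σ).1 (existsUnique_paired σ r.1).choose_spec.1)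

lemma dyckMatching_paired {N : ℕ} (σ : Bridge N) (b : Blue σ) :
    Paired σ b.1 (dyckMatching σ b).1 :=
  (existsUnique_paired σ b.1).choose_spec.1

/-! ### Positions and costs -/

/-- The position `s₀ + ⋯ + sᵢ` of the `i`-th point (counting from `0`), where `s` is the vector of
the `n + 1` spacings of `n` points in an interval. -/
def position {n : ℕ} (s : Fin (n + 1) → ℝ) (i : Fin n) : ℝ :=
  ∑ j ∈ Finset.Iic i.castSucc, s j

/-- The cost `∑ |x - y| ^ p` of a matching `π` of the blue with the red points. -/
noncomputable def cost {N : ℕ} (p : ℝ) (s : Fin (2 * N + 1) → ℝ) {σ : Bridge N}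
    (π : Blue σ ≃ Red σ) : ℝ :=
  ∑ b : Blue σ, |position s b.1 - position s (π b).1| ^ p

/-! ### The three laws of the spacings -/

/-- The spacings of the sorted list of `0`, `L` and the `n` points `u`. -/
noncomputable def spacings {n : ℕ} (L : ℝ) (u : Fin n → ℝ) : Fin (n + 1) → ℝ :=
  let x : Fin (n + 2) → ℝ :=
    Fin.cons (α := fun _ => ℝ) 0 (Fin.snoc (α := fun _ => ℝ) (u ∘ Tuple.sort u) L)
  fun i => x i.succ - x i.castSucc

lemma measurable_sorted {n : ℕ} : Measurable fun u : Fin n → ℝ => u ∘ Tuple.sort u := by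
  classical
  refine measurable_pi_lambda _ fun j => measurable_of_Iic fun a => ?_
  have h : (fun u : Fin n → ℝ => (u ∘ Tuple.sort u) j) ⁻¹' Set.Iic a
      = ⋃ t ∈ {t : Finset (Fin n) | j.val < t.card}, ⋂ i ∈ t, {u | u i ≤ a} := by
    ext u
    have hm := Tuple.monotone_sort u
    simp only [Set.mem_preimage, Set.mem_Iic, Set.mem_iUnion, Set.mem_iInter, Set.mem_ofPred_eq,
      exists_prop]
    constructor
    · intro hj
      refine ⟨(Finset.Iic j).map (Tuple.sort u).toEmbedding, by simp, ?_⟩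
      intro i hi
      obtain ⟨k, hk, rfl⟩ := Finset.mem_map.1 hi
      exact (hm (Finset.mem_Iic.1 hk)).trans hj
    · rintro ⟨t, ht, hta⟩
      by_contra hj
      have hsub : t.map (Tuple.sort u).symm.toEmbedding ⊆ Finset.Iio j := by
        intro k hk
        obtain ⟨i, hi, rfl⟩ := Finset.mem_map.1 hk
        rw [Finset.mem_Iio]
        by_contra hlt
        have h1 := hm (not_lt.1 hlt)
        have h2 := hta i hi
        simp only [Function.comp_apply, Equiv.coe_toEmbedding, Equiv.apply_symm_apply] at h1 hj
        exact hj (h1.trans h2)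
      have := Finset.card_le_card hsub
      simp at this
      omega
  rw [h]
  refine MeasurableSet.biUnion (Set.to_countable _) fun t _ =>
    MeasurableSet.biInter (Set.to_countable _) fun i _ => ?_
  exact measurableSet_le (measurable_pi_apply i) measurable_const

lemma measurable_spacings {n : ℕ} (L : ℝ) : Measurable (spacings (n := n) L) := by
  have hx : ∀ k : Fin (n + 2), Measurable fun u : Fin n → ℝ =>
      Fin.cons (α := fun _ => ℝ) 0 (Fin.snoc (α := fun _ => ℝ) (u ∘ Tuple.sort u) L) k := by
    intro k
    refine Fin.cases ?_ (fun k => ?_) k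
    · simp
    · refine Fin.lastCases ?_ (fun k => ?_) k
      · simp
      · simp only [Fin.cons_succ, Fin.snoc_castSucc]
        exact (measurable_pi_apply k).comp measurable_sorted
  exact measurable_pi_lambda _ fun i => (hx _).sub (hx _)

/-- The three models: exponential spacings, uniform spacings, Poisson point process. -/
inductive Model
  | ES
  | US
  | PPP

/-- The law of the `2 * N + 1` spacings: i.i.d. exponential variables of mean one (ES), all
identically equal to one (US), or the spacings of `2 * N` independent uniform points in the
interval `[0, 2 * N + 1]` (PPP). -/
noncomputable def spacingLaw (M : Model) (N : ℕ) : Measure (Fin (2 * N + 1) → ℝ) :=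
  match M with
  | Model.ES => Measure.pi fun _ => expMeasure 1
  | Model.US => Measure.dirac fun _ => 1
  | Model.PPP =>
      (Measure.pi fun _ : Fin (2 * N) => cond volume (Set.Icc (0 : ℝ) (2 * N + 1))).map
        (spacings (2 * N + 1))

/-- The expected cost of the Dyck matching, for independent spacings and colours, the colour
sequence being uniformly distributed on all bridges. -/
noncomputable def meanDyckCost (M : Model) (p : ℝ) (N : ℕ) : ℝ :=
  (Fintype.card (Bridge N) : ℝ)⁻¹ *
    ∑ σ : Bridge N, ∫ s, cost p s (dyckMatching σ) ∂(spacingLaw M N)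

/-- The ratio of the two sequences tends to a finite nonzero constant. -/
def SameOrder (a b : ℕ → ℝ) : Prop :=
  ∃ c : ℝ, c ≠ 0 ∧ Tendsto (fun N => a N / b N) atTop (𝓝 c)

end DyckAssignment

namespace DyckAssignment

/-! ### Words of steps -/

/-! The mean cost is a sum over potential arcs. In each model the expected cost of an arc depends
only on its length `l`, as `g N * φ l` with `g N → 1` and `φ l ~ l ^ p` (`exists_arc_moments`), so
it remains to count arcs of each length.

A bridge of length `2N` with an arc of length `2k + 1` starting at step `i` factors uniquely as `u e
d (-e) v`, where `d` is one of `catalan k` Dyck words and `uv` is a closed word of length `2M`, `M =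
N - 1 - k`, cut at `i`. The sign `e` is forced if the height at the cut is nonzero and free if it is
zero. Summing over `i` gives `catalan k * ((2M + 1) * centralBinom M + 4 ^ M)`
(`sum_ncard_arcWords`), the last term being the convolution square of the central binomial
coefficients.

Let `r n = 4⁻ⁿ * centralBinom n` (`returnProb`), `w k = 4⁻ᵏ * catalan k * φ (2k + 1)` (`arcWeight`),
and let `S` be the partial sums of `w`. Since `r 0 + ⋯ + r M = (2M + 1) * r M`, the mean cost is
exactly `g N / (4 * r N) * (∑ j < N, r j * S (N - j) + S N)`. As `r n ~ (π n) ^ (-1/2)`, a regularly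
varying `S` makes the convolution equivalent to a positive constant times `√N * S N`
(`tendsto_convolution`), hence the mean cost is of order `N * S N`. Finally `w k` behaves like `k ^
(p - 3/2)`, so `S` converges, grows like `log N`, or grows like `N ^ (p - 1/2)` according to the
position of `p` relative to `1/2`.

For exponential spacings, `φ l` is the `p`-th moment of a sum of `l` variables, compared with `l ^
p` through the variance. For PPP, spacings of uniform points are exponential spacings conditioned on
their total; on functions homogeneous of degree `p` the two expectations therefore differ by a fixed
factor (`exists_lintegral_pi_exp_eq`), which is identified by testing on the total length. -/

/-- Total displacement of a word of steps. -/
def walkSum (l : List ℤˣ) : ℤ := (l.map fun e : ℤˣ => (e : ℤ)).sum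

@[simp] lemma walkSum_nil : walkSum [] = 0 := rfl

@[simp] lemma walkSum_cons (e : ℤˣ) (l : List ℤˣ) : walkSum (e :: l) = e + walkSum l := by
  simp [walkSum]

@[simp] lemma walkSum_append (l l' : List ℤˣ) : walkSum (l ++ l') = walkSum l + walkSum l' := by
  simp [walkSum]

lemma walkSum_take_ofFn {n : ℕ} (f : Fin n → ℤˣ) (m : ℕ) :
    walkSum ((List.ofFn f).take m) = ∑ i : Fin n with i.val < m, (f i : ℤ) := by
  rw [walkSum, List.map_take, List.map_ofFn, List.sum_take_ofFn]
  rfl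

lemma walkSum_ofFn {n : ℕ} (f : Fin n → ℤˣ) :
    walkSum (List.ofFn f) = ∑ i : Fin n, (f i : ℤ) := by
  rw [walkSum, List.map_ofFn, List.sum_ofFn]
  rfl

lemma even_walkSum_add_length (l : List ℤˣ) : Even (walkSum l + l.length) := by
  induction l with
  | nil => simp
  | cons e l ih =>
    rcases Int.units_eq_one_or e with h | h <;> rw [h] <;> simp <;> grind

/-- Words of length `n` that return to their starting level. -/
def closedWords (n : ℕ) : Set (List ℤˣ) := {l | l.length = n ∧ walkSum l = 0}

lemma finite_closedWords (n : ℕ) : (closedWords n).Finite :=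
  (List.finite_length_eq ℤˣ n).subset fun _ h => h.1

/-- Words of length `2 * n` that stay weakly on the side `e` and return to their starting level. -/
def dyckWords (e : ℤˣ) (n : ℕ) : Set (List ℤˣ) :=
  {d | d.length = 2 * n ∧ walkSum d = 0 ∧ ∀ m, 0 ≤ (e : ℤ) * walkSum (d.take m)}

lemma finite_dyckWords (e : ℤˣ) (n : ℕ) : (dyckWords e n).Finite :=
  (List.finite_length_eq ℤˣ (2 * n)).subset fun _ h => h.1

/-- The set of blue indices determines the colours, and the colours sum to zero exactly when this
set has `N` elements. -/
lemma card_bridge (N : ℕ) : Fintype.card (Bridge N) = N.centralBinom := by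
  have key : ∀ s : Finset (Fin (2 * N)),
      ∑ i, ((if i ∈ s then (1 : ℤˣ) else -1 : ℤˣ) : ℤ) = 2 * s.card - 2 * N := by
    intro s
    have h : ∀ i, ((if i ∈ s then (1 : ℤˣ) else -1 : ℤˣ) : ℤ) = 2 * (if i ∈ s then 1 else 0) - 1 := by
      intro i; split_ifs <;> simp
    simp_rw [h, Finset.sum_sub_distrib, ← Finset.mul_sum]
    simp
  have hc : (Finset.powersetCard N (Finset.univ : Finset (Fin (2 * N)))).card
      = N.centralBinom := by
    rw [Finset.card_powersetCard, Finset.card_fin, Nat.centralBinom_eq_two_mul_choose]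
  rw [← hc, Fintype.card]
  refine Finset.card_bij' (fun σ _ => Finset.univ.filter fun i => σ.1 i = 1)
    (fun s hs => ⟨fun i => if i ∈ s then 1 else -1, by
      rw [key, (Finset.mem_powersetCard.1 hs).2]; simp⟩) ?_ ?_ ?_ ?_
  · intro σ _
    have h := key (Finset.univ.filter fun i => σ.1 i = 1)
    have h2 : ∀ i, (if i ∈ (Finset.univ.filter fun i => σ.1 i = 1) then (1 : ℤˣ) else -1) = σ.1 i := by
      intro i
      rcases Int.units_eq_one_or (σ.1 i) with h | h <;> simp [h]
    simp_rw [h2, σ.2] at h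
    rw [Finset.mem_powersetCard]
    exact ⟨Finset.subset_univ _, by omega⟩
  · intro s hs; simp
  · intro σ _
    ext i
    rcases Int.units_eq_one_or (σ.1 i) with h | h <;> simp [h]
  · intro s hs
    ext i
    simp

/-- Bridges as words. -/
def bridgeEquiv (N : ℕ) : Bridge N ≃ closedWords (2 * N) where
  toFun σ := ⟨List.ofFn σ.1, by simp, by rw [walkSum_ofFn, σ.2]⟩
  invFun l := ⟨fun i => l.1.get (i.cast l.2.1.symm), by
    have h : List.ofFn (fun i : Fin (2 * N) => l.1.get (i.cast l.2.1.symm)) = l.1 := by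
      apply List.ext_get
      · simp [l.2.1]
      · intro n h1 h2; simp
    rw [← walkSum_ofFn, h, l.2.2]⟩
  left_inv σ := by ext i; simp
  right_inv l := by
    apply Subtype.ext
    apply List.ext_get
    · simp [l.2.1]
    · intro n h1 h2; simp

lemma ncard_closedWords_even (M : ℕ) : (closedWords (2 * M)).ncard = M.centralBinom := by
  rw [← card_bridge, ← Nat.card_eq_fintype_card, Nat.card_congr (bridgeEquiv M)]
  rfl

lemma ncard_closedWords_odd (n : ℕ) (hn : Odd n) : (closedWords n).ncard = 0 := by
  rw [Set.ncard_eq_zero (finite_closedWords n)]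
  ext l
  simp only [closedWords, Set.mem_ofPred_eq, Set.mem_empty_iff_false, iff_false, not_and]
  intro h1 h2
  have := even_walkSum_add_length l
  rw [h1, h2, zero_add] at this
  grind

/-- Up steps go in direction `e`. -/
def stepEquiv (e : ℤˣ) : DyckStep ≃ ℤˣ where
  toFun s := match s with
    | DyckStep.U => e
    | DyckStep.D => -e
  invFun x := if x = e then DyckStep.U else DyckStep.D
  left_inv s := by
    cases s
    · simp
    · rcases Int.units_eq_one_or e with h | h <;> rw [h] <;> decide
  right_inv x := by
    rcases Int.units_eq_one_or e with h | h <;> rcases Int.units_eq_one_or x with h' | h' <;>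
      rw [h, h'] <;> decide

lemma walkSum_map_stepEquiv (e : ℤˣ) (l : List DyckStep) :
    walkSum (l.map (stepEquiv e)) = e * ((l.count DyckStep.U : ℤ) - l.count DyckStep.D) := by
  induction l with
  | nil => simp
  | cons s l ih =>
    have hU : stepEquiv e DyckStep.U = e := rfl
    have hD : stepEquiv e DyckStep.D = -e := rfl
    cases s <;> simp [hU, hD, ih] <;> ring

/-- Relabelling the steps by `stepEquiv e` identifies these words with `DyckWord`s: the sign
condition on prefixes becomes the condition that no prefix contains more `D` than `U`. -/
lemma ncard_dyckWords (e : ℤˣ) (n : ℕ) : (dyckWords e n).ncard = catalan n := by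
  rw [← DyckWord.card_dyckWord_semilength_eq_catalan, ← Nat.card_eq_fintype_card]
  have hsq : (e : ℤ) * e = 1 := by
    rcases Int.units_eq_one_or e with h | h <;> rw [h] <;> simp
  have hnonneg : ∀ l : List DyckStep, 0 ≤ (e : ℤ) * walkSum (l.map (stepEquiv e)) ↔
      l.count DyckStep.D ≤ l.count DyckStep.U := by
    intro l
    rw [walkSum_map_stepEquiv, ← mul_assoc, hsq, one_mul]
    omega
  have hzero : ∀ l : List DyckStep, walkSum (l.map (stepEquiv e)) = 0 ↔
      l.count DyckStep.U = l.count DyckStep.D := by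
    intro l
    rw [walkSum_map_stepEquiv, mul_eq_zero]
    have := e.ne_zero
    omega
  refine Nat.card_congr
    { toFun := fun d => ⟨⟨d.1.map (stepEquiv e).symm, ?_, ?_⟩, ?_⟩
      invFun := fun w => ⟨w.1.toList.map (stepEquiv e), ?_, ?_, ?_⟩
      left_inv := fun d => Subtype.ext (by simp)
      right_inv := fun w => Subtype.ext (DyckWord.ext (by simp)) }
  · rw [← hzero]; simpa using d.2.2.1
  · intro m
    rw [← hnonneg]; simpa using d.2.2.2 m
  · have h := DyckWord.two_mul_semilength_eq_length (p := ⟨d.1.map (stepEquiv e).symm, by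
      rw [← hzero]; simpa using d.2.2.1, by
      intro m; rw [← hnonneg]; simpa using d.2.2.2 m⟩)
    simp only [List.length_map, d.2.1] at h
    omega
  · have h := DyckWord.two_mul_semilength_eq_length (p := w.1)
    rw [w.2] at h
    simp [h]
  · rw [hzero]; exact w.1.count_U_eq_count_D
  · intro m
    rw [← List.map_take, hnonneg]; exact w.1.count_D_le_count_U m

/-! ### Counting arcs -/

/-- Closed words of length `n` in which an arc of length `2 * k + 1` starts at step `i`. -/
def arcWords (n i k : ℕ) : Set (List ℤˣ) :=
  {l | ∃ e u d v, l = u ++ e :: (d ++ (-e) :: v) ∧ u.length = i ∧ l.length = n ∧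
    walkSum u + walkSum v = 0 ∧ 0 ≤ (e : ℤ) * walkSum u ∧ d ∈ dyckWords e k}

lemma height_eq_walkSum {N : ℕ} (σ : Bridge N) (m : ℕ) :
    height σ m = walkSum ((List.ofFn σ.1).take m) := by
  rw [walkSum_take_ofFn, height]

lemma walkSum_take_drop (l : List ℤˣ) (a b : ℕ) :
    walkSum ((l.drop a).take b) = walkSum (l.take (a + b)) - walkSum (l.take a) := by
  rw [List.take_add, walkSum_append]
  ring

/-- The word is cut at the two end steps of the arc. The part strictly between them is closed, hence
of even length, and `arc_pos` keeps it on the side of the opening step. -/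
lemma exists_of_isArc {N : ℕ} {σ : Bridge N} {i j : Fin (2 * N)} (h : IsArc σ i j) :
    ∃ k, j.val = i.val + 2 * k + 1 ∧ List.ofFn σ.1 ∈ arcWords (2 * N) i k := by
  have hpos := arc_pos σ h
  have hsign := arc_sign σ h
  obtain ⟨hij, ho, hc, -⟩ := h
  rw [Fin.lt_def] at hij
  set l := List.ofFn σ.1 with hl
  have hlen : l.length = 2 * N := by simp [hl]
  have hi : l[i.val]'(by omega) = σ.1 i := by simp [hl]
  have hj : l[j.val]'(by omega) = σ.1 j := by simp [hl]
  set d := (l.drop (i + 1)).take (j - i - 1) with hd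
  have hdl : d.length = j - i - 1 := by
    simp only [hd, List.length_take, List.length_drop]
    omega
  have hsi := height_succ σ i
  have hsj := height_succ σ j
  have hd0 : walkSum d = 0 := by
    rw [hd, walkSum_take_drop, ← height_eq_walkSum, ← height_eq_walkSum,
      show i.val + 1 + (j - i - 1) = j by omega]
    rw [hc, hsign] at hsj
    push_cast at hsj
    linarith
  have hev := even_walkSum_add_length d
  rw [hd0, zero_add, hdl] at hev
  obtain ⟨k, hk⟩ : ∃ k : ℕ, j.val - i - 1 = k + k := by
    obtain ⟨k, hk⟩ := hev
    exact ⟨k.toNat, by omega⟩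
  have hdec : l = l.take i ++ σ.1 i :: (d ++ (-σ.1 i) :: l.drop (j + 1)) := by
    have h1 : l.drop j = (-σ.1 i) :: l.drop (j + 1) := by
      rw [List.drop_eq_getElem_cons (by omega), hj, hsign]
    have h2 : l.drop i = σ.1 i :: l.drop (i + 1) := by
      rw [List.drop_eq_getElem_cons (by omega), hi]
    rw [← h1, hd]
    have h3 : l.drop j = (l.drop (i + 1)).drop (j - i - 1) := by
      rw [List.drop_drop]
      congr 1
      omega
    rw [h3, List.take_append_drop, ← h2, List.take_append_drop]
  refine ⟨k, by omega, σ.1 i, l.take i, d, l.drop (j + 1), hdec, ?_, hlen, ?_, ?_, ?_, hd0, ?_⟩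
  · rw [List.length_take]; omega
  · have h1 := congrArg walkSum hdec
    simp only [walkSum_append, walkSum_cons, hd0] at h1
    rw [hl, walkSum_ofFn, σ.2, ← hl] at h1
    push_cast at h1
    linarith
  · rw [← height_eq_walkSum]
    exact (open_iff σ i).1 ho
  · omega
  · intro m
    rw [hd, List.take_take, walkSum_take_drop, ← height_eq_walkSum, ← height_eq_walkSum]
    have h1 := hpos (i + 1 + min m (j - i - 1)) (by omega) (by omega)
    rw [hsi]
    have hsq : (σ.1 i : ℤ) * (σ.1 i : ℤ) = 1 := by
      rcases Int.units_eq_one_or (σ.1 i) with h1 | h1 <;> rw [h1] <;> simp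
    linarith

/-- Inside the arc the height is that of `u`, plus `e`, plus a prefix sum of `d`. Since `d` stays
weakly on the side `e`, the extra `e` keeps the walk strictly off its starting level until the
closing step. -/
lemma isArc_of_mem {N k : ℕ} {σ : Bridge N} {i j : Fin (2 * N)} (hj : j.val = i.val + 2 * k + 1)
    (h : List.ofFn σ.1 ∈ arcWords (2 * N) i k) : IsArc σ i j := by
  obtain ⟨e, u, d, v, hl, hu, hlen, hs, he, hd1, hd2, hd3⟩ := h
  have hi : height σ i = walkSum u := by
    rw [height_eq_walkSum, hl, List.take_left' hu]
  have hm : ∀ r ≤ 2 * k, height σ (i + 1 + r) = walkSum u + e + walkSum (d.take r) := by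
    intro r hr
    rw [height_eq_walkSum, hl, ← hu, add_assoc, List.take_length_add_append, add_comm 1 r,
      List.take_succ_cons, List.take_append_of_le_length (by omega)]
    simp [add_assoc]
  have hend : height σ (j + 1) = walkSum u := by
    have h1 : j.val + 1 = u.length + ((d.length + 1) + 1) := by omega
    rw [height_eq_walkSum, hl, h1, List.take_length_add_append, List.take_succ_cons,
      List.take_length_add_append]
    simp [hd2]
  refine ⟨by rw [Fin.lt_def]; omega, ?_, by rw [hend, hi], ?_⟩
  · have h1 := hm 0 (by omega)
    simp only [add_zero, List.take_zero, walkSum_nil] at h1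
    rw [hi, h1]
    rcases Int.units_eq_one_or e with h | h <;> rw [h] at he ⊢ <;> simp at he ⊢ <;> grind
  · intro m h1 h2
    obtain ⟨r, rfl⟩ : ∃ r, m = i + 1 + r := ⟨m - (i + 1), by omega⟩
    rw [hm r (by omega), hi]
    have h3 := hd3 r
    rcases Int.units_eq_one_or e with h | h <;> rw [h] at h3 ⊢ <;> simp at h3 ⊢ <;> omega

lemma isArc_iff {N k : ℕ} {σ : Bridge N} {i j : Fin (2 * N)} (hj : j.val = i.val + 2 * k + 1) :
    IsArc σ i j ↔ List.ofFn σ.1 ∈ arcWords (2 * N) i k := by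
  refine ⟨fun h => ?_, isArc_of_mem hj⟩
  obtain ⟨k', h1, h2⟩ := exists_of_isArc h
  obtain rfl : k' = k := by omega
  exact h2

/-- Pairs of words of lengths `i` and `r` with total displacement zero, the first one ending weakly
on the side `e`. -/
def splitWords (e : ℤˣ) (i r : ℕ) : Set (List ℤˣ × List ℤˣ) :=
  {q | q.1.length = i ∧ q.2.length = r ∧ walkSum q.1 + walkSum q.2 = 0 ∧
    0 ≤ (e : ℤ) * walkSum q.1}

lemma finite_splitWords (e : ℤˣ) (i r : ℕ) : (splitWords e i r).Finite :=
  ((List.finite_length_eq ℤˣ i).prod (List.finite_length_eq ℤˣ r)).subset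
    fun _ h => ⟨h.1, h.2.1⟩

/-- Inclusion-exclusion over the two signs: the union consists of all closed words cut at `i`, the
intersection of those that are at height zero at the cut, where both halves are closed. -/
lemma ncard_splitWords (i r : ℕ) :
    (splitWords 1 i r).ncard + (splitWords (-1) i r).ncard =
      (closedWords (i + r)).ncard + (closedWords i).ncard * (closedWords r).ncard := by
  rw [← Set.ncard_union_add_ncard_inter _ _ (finite_splitWords _ _ _) (finite_splitWords _ _ _),
    ← Set.ncard_prod]
  congr 1
  · refine Set.ncard_congr (fun q _ => q.1 ++ q.2) ?_ ?_ ?_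
    · rintro ⟨u, v⟩ (h | h) <;> simp [closedWords, h.1, h.2.1, h.2.2.1]
    · rintro ⟨u, v⟩ ⟨u', v'⟩ h h' heq
      have h1 : u.length = i := by rcases h with h | h <;> exact h.1
      have h2 : u'.length = i := by rcases h' with h | h <;> exact h.1
      obtain ⟨rfl, rfl⟩ := List.append_inj heq (h1.trans h2.symm)
      rfl
    · intro l hl
      refine ⟨(l.take i, l.drop i), ?_, List.take_append_drop i l⟩
      have h1 : (l.take i).length = i := by rw [List.length_take, hl.1]; omega
      have h2 : (l.drop i).length = r := by rw [List.length_drop, hl.1]; omega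
      have h3 : walkSum (l.take i) + walkSum (l.drop i) = 0 := by
        rw [← walkSum_append, List.take_append_drop, hl.2]
      rcases le_total 0 (walkSum (l.take i)) with h | h
      · exact Or.inl ⟨h1, h2, h3, by simpa using h⟩
      · exact Or.inr ⟨h1, h2, h3, by simpa using h⟩
  · congr 1
    ext ⟨u, v⟩
    simp only [splitWords, closedWords, Set.mem_inter_iff, Set.mem_prod, Set.mem_ofPred_eq]
    simp only [Units.val_one, one_mul, Units.val_neg, neg_mul]
    constructor
    · rintro ⟨⟨h1, h2, h3, h4⟩, -, -, -, h5⟩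
      exact ⟨⟨h1, by omega⟩, h2, by omega⟩
    · rintro ⟨⟨h1, h2⟩, h3, h4⟩
      exact ⟨⟨h1, h3, by omega, by omega⟩, h1, h3, by omega, by omega⟩

/-- The lengths of `u` and `d` are prescribed, so the factorisation of a word, including the sign
`e`, is unique. The count is thus a product of independent choices for each sign, added over the two
signs. -/
lemma ncard_arcWords (i r k : ℕ) :
    (arcWords (i + r + 2 * k + 2) i k).ncard = catalan k *
      ((closedWords (i + r)).ncard + (closedWords i).ncard * (closedWords r).ncard) := by
  set f : ℤˣ → (List ℤˣ × List ℤˣ) × List ℤˣ → List ℤˣ :=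
    fun e q => q.1.1 ++ e :: (q.2 ++ (-e) :: q.1.2) with hf
  have hinj : ∀ e e' : ℤˣ, ∀ q ∈ splitWords e i r ×ˢ dyckWords e k,
      ∀ q' ∈ splitWords e' i r ×ˢ dyckWords e' k, f e q = f e' q' → e = e' ∧ q = q' := by
    rintro e e' ⟨⟨u, v⟩, d⟩ ⟨h1, h2⟩ ⟨⟨u', v'⟩, d'⟩ ⟨h1', h2'⟩ heq
    obtain ⟨h3, h4⟩ := List.append_inj heq (h1.1.trans h1'.1.symm)
    simp only [List.cons.injEq] at h3 h4
    obtain ⟨h5, h6⟩ := List.append_inj h4.2 (h2.1.trans h2'.1.symm)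
    simp only [List.cons.injEq] at h5 h6
    rw [h3, h4.1, h5, h6.2]
    exact ⟨rfl, rfl⟩
  have hfin : ∀ e : ℤˣ, (splitWords e i r ×ˢ dyckWords e k).Finite :=
    fun e => (finite_splitWords e i r).prod (finite_dyckWords e k)
  have hcard : ∀ e : ℤˣ, (f e '' (splitWords e i r ×ˢ dyckWords e k)).ncard =
      (splitWords e i r).ncard * catalan k := by
    intro e
    rw [Set.InjOn.ncard_image fun q hq q' hq' h => (hinj e e q hq q' hq' h).2, Set.ncard_prod,
      ncard_dyckWords]
  have hdisj : Disjoint (f 1 '' (splitWords 1 i r ×ˢ dyckWords 1 k))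
      (f (-1) '' (splitWords (-1) i r ×ˢ dyckWords (-1) k)) := by
    rw [Set.disjoint_left]
    rintro _ ⟨q, hq, rfl⟩ ⟨q', hq', h⟩
    exact absurd (hinj _ _ _ hq' _ hq h).1 (by decide)
  have hset : arcWords (i + r + 2 * k + 2) i k = f 1 '' (splitWords 1 i r ×ˢ dyckWords 1 k) ∪
      f (-1) '' (splitWords (-1) i r ×ˢ dyckWords (-1) k) := by
    have hmem : ∀ l, l ∈ arcWords (i + r + 2 * k + 2) i k ↔
        ∃ e, l ∈ f e '' (splitWords e i r ×ˢ dyckWords e k) := by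
      intro l
      constructor
      · rintro ⟨e, u, d, v, rfl, hu, hlen, hs, he, hd⟩
        refine ⟨e, ((u, v), d), ⟨⟨hu, ?_, hs, he⟩, hd⟩, rfl⟩
        simp only [List.length_append, List.length_cons, hd.1, hu] at hlen
        simp only
        omega
      · rintro ⟨e, ⟨⟨u, v⟩, d⟩, ⟨⟨h1, h2, h3, h4⟩, h5⟩, rfl⟩
        refine ⟨e, u, d, v, rfl, h1, ?_, h3, h4, h5⟩
        simp only at h1 h2
        simp only [hf, List.length_append, List.length_cons, h5.1, h1, h2]
        omega
    ext l
    rw [hmem, Set.mem_union]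
    constructor
    · rintro ⟨e, h⟩
      rcases Int.units_eq_one_or e with rfl | rfl
      · exact Or.inl h
      · exact Or.inr h
    · rintro (h | h)
      · exact ⟨_, h⟩
      · exact ⟨_, h⟩
  rw [hset, Set.ncard_union_eq hdisj ((hfin _).image _) ((hfin _).image _), hcard, hcard,
    ← ncard_splitWords]
  ring

open Classical in
lemma card_isArc {N i k : ℕ} (hik : i + 2 * k + 1 < 2 * N) :
    (Finset.univ.filter fun σ : Bridge N =>
      IsArc σ ⟨i, by omega⟩ ⟨i + 2 * k + 1, hik⟩).card = (arcWords (2 * N) i k).ncard := by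
  rw [← Set.ncard_coe_finset]
  refine Set.ncard_congr (fun σ _ => List.ofFn σ.1) ?_ ?_ ?_
  · intro σ hσ
    simp only [Finset.coe_filter, Finset.mem_univ, true_and, Set.mem_ofPred_eq] at hσ
    exact (isArc_iff rfl).1 hσ
  · intro σ σ' _ _ h
    exact Subtype.ext (List.ofFn_injective h)
  · intro l hl
    have hcl : l ∈ closedWords (2 * N) := by
      obtain ⟨e, u, d, v, rfl, hu, hlen, hs, he, hd⟩ := hl
      refine ⟨hlen, ?_⟩
      simp only [walkSum_append, walkSum_cons, hd.2.1]
      push_cast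
      linarith
    have h1 : List.ofFn ((bridgeEquiv N).symm ⟨l, hcl⟩).1 = l :=
      congrArg Subtype.val ((bridgeEquiv N).apply_symm_apply ⟨l, hcl⟩)
    refine ⟨(bridgeEquiv N).symm ⟨l, hcl⟩, ?_, h1⟩
    simp only [Finset.coe_filter, Finset.mem_univ, true_and, Set.mem_ofPred_eq]
    rw [isArc_iff rfl, h1]
    exact hl

/-- The convolution square of the central binomial coefficients. -/
lemma sum_centralBinom_mul_centralBinom (M : ℕ) :
    ∑ j ∈ Finset.range (M + 1), j.centralBinom * (M - j).centralBinom = 4 ^ M := by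
  set S : ℕ → ℕ := fun M => ∑ j ∈ Finset.range (M + 1), j.centralBinom * (M - j).centralBinom
  -- Under the symmetry `j ↔ M - j` the average of `j` against the symmetric weights is `M / 2`.
  have hsymm : ∀ M, 2 * ∑ j ∈ Finset.range (M + 1), j * (j.centralBinom * (M - j).centralBinom) =
      M * S M := by
    intro M
    rw [two_mul]
    nth_rewrite 2 [← Finset.sum_range_reflect]
    rw [← Finset.sum_add_distrib, Finset.mul_sum]
    refine Finset.sum_congr rfl fun j hj => ?_
    have hj' := Finset.mem_range.1 hj
    obtain ⟨r, rfl⟩ : ∃ r, M = j + r := ⟨M - j, by omega⟩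
    rw [show j + r + 1 - 1 - j = r by omega, show j + r - j = r by omega,
      show j + r - r = j by omega]
    ring
  -- Weighting the terms by `j` lets the recursion `(j + 1) * centralBinom (j + 1) = 2 * (2 * j + 1)
  -- * centralBinom j` apply; `hsymm` then removes the weights on both sides.
  have hrec : ∀ M, S (M + 1) = 4 * S M := by
    intro M
    have h1 := hsymm (M + 1)
    rw [Finset.sum_range_succ'] at h1
    have h2 : ∀ j ∈ Finset.range (M + 1),
        (j + 1) * ((j + 1).centralBinom * (M + 1 - (j + 1)).centralBinom) =
          4 * (j * (j.centralBinom * (M - j).centralBinom)) +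
            2 * (j.centralBinom * (M - j).centralBinom) := by
      intro j _
      rw [← mul_assoc, Nat.succ_mul_centralBinom_succ, Nat.add_sub_add_right]
      ring
    rw [Finset.sum_congr rfl h2, Finset.sum_add_distrib, ← Finset.mul_sum, ← Finset.mul_sum] at h1
    have h3 := hsymm M
    have h4 : (M + 1) * S (M + 1) = (M + 1) * (4 * S M) := by
      have h5 : S M = ∑ j ∈ Finset.range (M + 1), j.centralBinom * (M - j).centralBinom := rfl
      rw [← h5] at h1
      linarith
    exact Nat.eq_of_mul_eq_mul_left (by omega) h4
  change S M = _
  induction M with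
  | zero => simp [S]
  | succ M ih => rw [hrec, ih, pow_succ]; ring

lemma sum_ncard_arcWords (M k : ℕ) :
    ∑ i ∈ Finset.range (2 * M + 1), (arcWords (2 * M + 2 * k + 2) i k).ncard =
      catalan k * ((2 * M + 1) * M.centralBinom + 4 ^ M) := by
  have h1 : ∀ i ∈ Finset.range (2 * M + 1), (arcWords (2 * M + 2 * k + 2) i k).ncard =
      catalan k * (M.centralBinom + (closedWords i).ncard * (closedWords (2 * M - i)).ncard) := by
    intro i hi
    have hi' := Finset.mem_range.1 hi
    have h := ncard_arcWords i (2 * M - i) k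
    rw [show i + (2 * M - i) = 2 * M by omega, ncard_closedWords_even] at h
    exact h
  have h2 : ∑ i ∈ Finset.range (2 * M + 1),
      (closedWords i).ncard * (closedWords (2 * M - i)).ncard = 4 ^ M := by
    rw [← sum_centralBinom_mul_centralBinom]
    symm
    -- Only even cut points contribute, because there are no closed words of odd length.
    refine Finset.sum_of_injOn (fun j => 2 * j) ?_ ?_ ?_ ?_
    · intro a _ b _ h
      simpa using h
    · intro a ha
      simp only [Finset.coe_range, Set.mem_Iio] at ha ⊢
      omega
    · intro i hi hni
      rw [ncard_closedWords_odd, zero_mul]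
      by_contra hodd
      rw [Nat.not_odd_iff_even] at hodd
      obtain ⟨j, rfl⟩ := hodd
      refine hni ⟨j, ?_, by simp only; omega⟩
      simp only [Finset.mem_range, Finset.coe_range, Set.mem_Iio] at hi ⊢
      omega
    · intro j hj
      rw [ncard_closedWords_even, ← Nat.mul_sub, ncard_closedWords_even]
  rw [Finset.sum_congr rfl h1, ← Finset.mul_sum, Finset.sum_add_distrib, h2]
  simp

open Classical in
/-- Summing over all bridges a function of the lengths of the arcs. -/
lemma sum_isArc (N : ℕ) (f : ℕ → ℝ) :
    ∑ σ : Bridge N, ∑ i, ∑ j, (if IsArc σ i j then f (j - i) else 0) =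
      ∑ k ∈ Finset.range N, (catalan k : ℝ) *
        ((2 * (N - 1 - k : ℕ) + 1) * (N - 1 - k).centralBinom + 4 ^ (N - 1 - k)) * f (2 * k + 1) := by
  have h1 : ∑ σ : Bridge N, ∑ i, ∑ j, (if IsArc σ i j then f (j - i) else 0) =
      ∑ q : Fin (2 * N) × Fin (2 * N),
        ((Finset.univ.filter fun σ : Bridge N => IsArc σ q.1 q.2).card : ℝ) * f (q.2 - q.1) := by
    have h2 : ∀ σ : Bridge N, ∑ i, ∑ j, (if IsArc σ i j then f (j - i) else 0) =
        ∑ q : Fin (2 * N) × Fin (2 * N), (if IsArc σ q.1 q.2 then f (q.2 - q.1) else 0) :=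
      fun σ => by rw [Fintype.sum_prod_type]
    rw [Finset.sum_congr rfl fun σ _ => h2 σ, Finset.sum_comm]
    refine Finset.sum_congr rfl fun q _ => ?_
    rw [← Finset.sum_filter, Finset.sum_const, nsmul_eq_mul]
  have h2 : ∀ k ∈ Finset.range N, (catalan k : ℝ) *
        ((2 * (N - 1 - k : ℕ) + 1) * (N - 1 - k).centralBinom + 4 ^ (N - 1 - k)) * f (2 * k + 1) =
      ∑ i ∈ Finset.range (2 * (N - 1 - k) + 1), ((arcWords (2 * N) i k).ncard : ℝ) *
        f (2 * k + 1) := by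
    intro k hk
    have hk' := Finset.mem_range.1 hk
    have h := sum_ncard_arcWords (N - 1 - k) k
    rw [show 2 * (N - 1 - k) + 2 * k + 2 = 2 * N by omega] at h
    rw [← Finset.sum_mul, ← Nat.cast_sum, h]
    push_cast
    ring
  rw [h1, Finset.sum_congr rfl h2, Finset.sum_sigma']
  symm
  have hlt : ∀ x : (_ : ℕ) × ℕ, x ∈ (Finset.range N).sigma
      (fun k => Finset.range (2 * (N - 1 - k) + 1)) → x.2 + 2 * x.1 + 1 < 2 * N := by
    intro x hx
    rw [Finset.mem_sigma, Finset.mem_range, Finset.mem_range] at hx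
    omega
  -- Pairs `(i, j)` not of the form `(i, i + 2 * k + 1)` carry no arc and contribute zero, so only
  -- nonzero terms need to be matched.
  refine Finset.sum_bij_ne_zero
    (fun x hx _ => (⟨x.2, by have := hlt x hx; omega⟩, ⟨x.2 + 2 * x.1 + 1, hlt x hx⟩)) ?_ ?_ ?_ ?_
  · intro x hx _
    exact Finset.mem_univ _
  · rintro ⟨k, i⟩ h1 _ ⟨k', i'⟩ h2 _ h
    simp only [Prod.mk.injEq, Fin.mk.injEq] at h
    obtain ⟨rfl, h⟩ := h
    obtain rfl : k = k' := by omega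
    rfl
  · rintro ⟨i, j⟩ _ hne
    have hpos := Nat.cast_ne_zero.1 (left_ne_zero_of_mul hne)
    obtain ⟨σ, hσ⟩ := Finset.card_pos.1 (Nat.pos_of_ne_zero hpos)
    obtain ⟨k, hk, -⟩ := exists_of_isArc (Finset.mem_filter.1 hσ).2
    dsimp only at hk
    have hj := j.2
    have hmem : (⟨k, i⟩ : (_ : ℕ) × ℕ) ∈ (Finset.range N).sigma
        (fun k => Finset.range (2 * (N - 1 - k) + 1)) := by
      rw [Finset.mem_sigma, Finset.mem_range, Finset.mem_range]
      simp only
      omega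
    have heq : (⟨i.val + 2 * k + 1, by omega⟩ : Fin (2 * N)) = j := Fin.ext hk.symm
    refine ⟨⟨k, i⟩, hmem, ?_, by rw [← heq]⟩
    rw [← card_isArc (hlt _ hmem)]
    simp only [heq]
    rwa [show 2 * k + 1 = j.val - i by omega]
  · intro x hx _
    simp only
    rw [card_isArc (hlt x hx)]
    congr 2
    omega

/-! ### The mean cost as a sum over arcs -/

lemma not_isArc_symm {N : ℕ} {σ : Bridge N} {i j : Fin (2 * N)} (h : IsArc σ i j) :
    ¬ IsArc σ j i := fun h' => lt_asymm h.1 h'.1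

open Classical in
-- The two ends of an arc have opposite colours, so each arc is seen from exactly one blue point,
-- either as its opening or as its closing step. Symmetry of `G` allows both cases to be written
-- from the opening end.
lemma sum_dyckMatching {N : ℕ} (σ : Bridge N) (G : Fin (2 * N) → Fin (2 * N) → ℝ)
    (hG : ∀ i j, G i j = G j i) :
    ∑ b : Blue σ, G b.1 (dyckMatching σ b).1 =
      ∑ i, ∑ j, if IsArc σ i j then G i j else 0 := by
  have h1 : ∀ b : Blue σ, G b.1 (dyckMatching σ b).1 =
      ∑ j, if Paired σ b.1 j then G b.1 j else 0 := by
    intro b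
    rw [Finset.sum_eq_single (dyckMatching σ b).1, if_pos (dyckMatching_paired σ b)]
    · intro j _ hj
      exact if_neg fun h => hj ((existsUnique_paired σ b.1).unique h (dyckMatching_paired σ b))
    · simp
  have h2 : ∀ i j, (if Paired σ i j then G i j else 0) =
      (if IsArc σ i j then G i j else 0) + (if IsArc σ j i then G j i else 0) := by
    intro i j
    by_cases ha : IsArc σ i j
    · simp [Paired, ha, not_isArc_symm ha]
    · by_cases hb : IsArc σ j i
      · simp [Paired, ha, hb, hG i j]
      · simp [Paired, ha, hb]
  have h3 : ∑ b : Blue σ, G b.1 (dyckMatching σ b).1 =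
      ∑ i, ∑ j, if σ.1 i = 1 then (if Paired σ i j then G i j else 0) else 0 := by
    rw [Finset.sum_congr rfl fun b _ => h1 b,
      ← Finset.sum_subtype (Finset.univ.filter fun i => σ.1 i = 1) (by simp)
        (fun i => ∑ j, if Paired σ i j then G i j else 0), Finset.sum_filter]
    refine Finset.sum_congr rfl fun i _ => ?_
    split_ifs <;> simp
  have h4 : ∀ i j, (if σ.1 i = 1 then (if Paired σ i j then G i j else 0) else 0) =
      (if σ.1 i = 1 then (if IsArc σ i j then G i j else 0) else 0) +
        (if σ.1 i = 1 then (if IsArc σ j i then G j i else 0) else 0) := by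
    intro i j
    by_cases hi : σ.1 i = 1
    · simp only [if_pos hi, h2 i j]
    · simp only [if_neg hi, add_zero]
  rw [h3]
  simp_rw [h4, Finset.sum_add_distrib]
  nth_rewrite 2 [Finset.sum_comm]
  simp_rw [← Finset.sum_add_distrib]
  refine Finset.sum_congr rfl fun i _ => Finset.sum_congr rfl fun j _ => ?_
  by_cases ha : IsArc σ i j
  · have := arc_sign σ ha
    rcases Int.units_eq_one_or (σ.1 i) with h | h
    · rw [h] at this
      simp [ha, h, this]
    · rw [h, neg_neg] at this
      simp [ha, h, this]
  · simp [ha]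

open Classical in
lemma cost_dyckMatching {N : ℕ} (p : ℝ) (s : Fin (2 * N + 1) → ℝ) (σ : Bridge N) :
    cost p s (dyckMatching σ) =
      ∑ i, ∑ j, if IsArc σ i j then |position s i - position s j| ^ p else 0 :=
  sum_dyckMatching σ (fun i j => |position s i - position s j| ^ p)
    fun i j => by rw [abs_sub_comm]

lemma integrable_cost {N : ℕ} {p : ℝ} {μ : Measure (Fin (2 * N + 1) → ℝ)}
    (h : ∀ i j : Fin (2 * N), i < j → Integrable (fun s => |position s i - position s j| ^ p) μ)
    (σ : Bridge N) : Integrable (fun s => cost p s (dyckMatching σ)) μ := by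
  classical
  simp_rw [cost_dyckMatching]
  refine integrable_finsetSum _ fun i _ => integrable_finsetSum _ fun j _ => ?_
  by_cases ha : IsArc σ i j
  · simpa [ha] using h i j ha.1
  · simp [ha]

lemma sum_integral_cost {N : ℕ} {p : ℝ} {μ : Measure (Fin (2 * N + 1) → ℝ)} {f : ℕ → ℝ}
    (h : ∀ i j : Fin (2 * N), i < j → Integrable (fun s => |position s i - position s j| ^ p) μ)
    (h' : ∀ i j : Fin (2 * N), i < j → ∫ s, |position s i - position s j| ^ p ∂μ = f (j - i)) :
    ∑ σ : Bridge N, ∫ s, cost p s (dyckMatching σ) ∂μ =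
      ∑ k ∈ Finset.range N, (catalan k : ℝ) *
        ((2 * (N - 1 - k : ℕ) + 1) * (N - 1 - k).centralBinom + 4 ^ (N - 1 - k)) *
          f (2 * k + 1) := by
  classical
  rw [← sum_isArc]
  refine Finset.sum_congr rfl fun σ _ => ?_
  simp_rw [cost_dyckMatching]
  have hint : ∀ i j, Integrable (fun s : Fin (2 * N + 1) → ℝ =>
      if IsArc σ i j then |position s i - position s j| ^ p else 0) μ := by
    intro i j
    by_cases ha : IsArc σ i j
    · simpa [ha] using h i j ha.1
    · simp [ha]
  rw [integral_finsetSum _ fun i _ => integrable_finsetSum _ fun j _ => hint i j]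
  refine Finset.sum_congr rfl fun i _ => ?_
  rw [integral_finsetSum _ fun j _ => hint i j]
  refine Finset.sum_congr rfl fun j _ => ?_
  by_cases ha : IsArc σ i j
  · simp [ha, h' i j ha.1]
  · simp [ha]

/-! ### Sums of independent exponential variables -/

instance isProbabilityMeasure_exp_one : IsProbabilityMeasure (expMeasure 1) :=
  isProbabilityMeasure_expMeasure one_pos

lemma exponentialPDFReal_one (x : ℝ) :
    exponentialPDFReal 1 x = (Set.Ici (0 : ℝ)).indicator (fun x => Real.exp (-x)) x := by
  by_cases h : 0 ≤ x <;> simp [exponentialPDFReal, gammaPDFReal, Set.indicator, h]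

lemma expMeasure_one :
    expMeasure 1 = volume.withDensity
      ((Set.Ici (0 : ℝ)).indicator fun x => ENNReal.ofReal (Real.exp (-x))) := by
  change volume.withDensity (exponentialPDF 1) = _
  congr 1
  ext x
  rw [exponentialPDF, exponentialPDFReal_one]
  by_cases h : 0 ≤ x <;> simp [Set.indicator, h]

lemma expMeasure_one_eq_restrict :
    expMeasure 1 = (volume.restrict (Set.Ioi (0 : ℝ))).withDensity
      (fun x => ENNReal.ofReal (Real.exp (-x))) := by
  rw [expMeasure_one, withDensity_indicator measurableSet_Ici, restrict_Ioi_eq_restrict_Ici]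

lemma ae_exp_pos : ∀ᵐ x ∂(expMeasure 1), 0 < x := by
  rw [expMeasure_one_eq_restrict]
  exact (withDensity_absolutelyContinuous _ _).ae_le (ae_restrict_mem measurableSet_Ioi)

lemma integrable_pow_exp (k : ℕ) : Integrable (fun x : ℝ => x ^ k) (expMeasure 1) := by
  rw [expMeasure_one_eq_restrict, integrable_withDensity_iff_integrable_smul' (by fun_prop) (by simp)]
  have h := Real.GammaIntegral_convergent (s := k + 1) (by positivity)
  simp only [add_sub_cancel_right, Real.rpow_natCast] at h
  refine h.congr (Eventually.of_forall fun x => ?_)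
  simp [ENNReal.toReal_ofReal (Real.exp_pos _).le]

lemma integral_pow_exp (k : ℕ) : ∫ x : ℝ, x ^ k ∂(expMeasure 1) = k.factorial := by
  rw [expMeasure_one_eq_restrict, integral_withDensity_eq_integral_toReal_smul (by fun_prop) (by simp)]
  have h := Real.Gamma_eq_integral (s := k + 1) (by positivity)
  rw [Real.Gamma_nat_eq_factorial] at h
  simp only [add_sub_cancel_right, Real.rpow_natCast] at h
  rw [h]
  refine integral_congr_ae (Eventually.of_forall fun x => ?_)
  simp [ENNReal.toReal_ofReal (Real.exp_pos _).le]

lemma memLp_exp : MemLp (fun x : ℝ => x) 2 (expMeasure 1) := by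
  exact (memLp_two_iff_integrable_sq (measurable_id.aestronglyMeasurable)).2
    (integrable_pow_exp 2)

lemma variance_exp : variance (fun x : ℝ => x) (expMeasure 1) = 1 := by
  rw [variance_eq_sub memLp_exp]
  have h1 := integral_pow_exp 1
  have h2 := integral_pow_exp 2
  simp only [pow_one] at h1
  simp only [Pi.pow_apply, h1, h2]
  norm_num

/-- Any `n` out of finitely many i.i.d. variables have the same sum in law. -/
lemma identDistrib_sum_pi {ι : Type*} [Fintype ι] (μ : Measure ℝ) [IsProbabilityMeasure μ]
    (A : Finset ι) {n : ℕ} (hA : A.card = n) :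
    IdentDistrib (fun s : ι → ℝ => ∑ j ∈ A, s j) (fun s : Fin n → ℝ => ∑ j, s j)
      (Measure.pi fun _ => μ) (Measure.pi fun _ => μ) := by
  let e : Fin n ≃ A := (Finset.equivFinOfCardEq hA).symm
  have hinj : Function.Injective fun i : Fin n => (e i : ι) :=
    Subtype.val_injective.comp e.injective
  have h : IdentDistrib (fun (s : ι → ℝ) (i : Fin n) => s (e i)) (fun (s : Fin n → ℝ) i => s i)
      (Measure.pi fun _ => μ) (Measure.pi fun _ => μ) := by
    refine IdentDistrib.pi (fun i => ⟨(measurable_pi_apply _).aemeasurable,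
      (measurable_pi_apply _).aemeasurable, ?_⟩) ?_ ?_
    · rw [(measurePreserving_eval (fun _ => μ) (e i : ι)).map_eq,
        (measurePreserving_eval (fun _ => μ) i).map_eq]
    · exact (iIndepFun_pi (μ := fun _ : ι => μ) (X := fun _ x => x)
        fun _ => aemeasurable_id).precomp hinj
    · exact iIndepFun_pi (μ := fun _ : Fin n => μ) (X := fun _ x => x) fun _ => aemeasurable_id
  have h2 := h.comp (u := fun x : Fin n → ℝ => ∑ i, x i) (by fun_prop)
  convert! h2 using 1
  ext s
  rw [← Finset.sum_coe_sort A]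
  exact (Equiv.sum_comp e (fun a : A => s a)).symm

lemma memLp_sum_exp (n : ℕ) :
    MemLp (fun s : Fin n → ℝ => ∑ j, s j) 2 (Measure.pi fun _ => expMeasure 1) :=
  memLp_finsetSum _ fun i _ =>
    memLp_exp.comp_measurePreserving (measurePreserving_eval (fun _ : Fin n => expMeasure 1) i)

lemma integral_sum_exp (n : ℕ) :
    ∫ s : Fin n → ℝ, ∑ j, s j ∂(Measure.pi fun _ => expMeasure 1) = n := by
  have h1 := integral_pow_exp 1
  simp only [pow_one] at h1
  have h2 : ∀ j, ∫ s : Fin n → ℝ, s j ∂(Measure.pi fun _ => expMeasure 1) = 1 := by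
    intro j
    have h := (measurePreserving_eval (fun _ : Fin n => expMeasure 1) j)
    have h3 := integral_map (μ := Measure.pi fun _ : Fin n => expMeasure 1)
      (φ := Function.eval j) (f := fun x : ℝ => x) (measurable_pi_apply _).aemeasurable
      measurable_id.aestronglyMeasurable
    rw [h.map_eq, h1] at h3
    simpa using h3.symm
  rw [integral_finsetSum]
  · simp [h2]
  · intro j _
    exact (memLp_exp.comp_measurePreserving
      (measurePreserving_eval (fun _ : Fin n => expMeasure 1) j)).integrable (by norm_num)

lemma variance_sum_exp (n : ℕ) :
    variance (fun s : Fin n → ℝ => ∑ j, s j) (Measure.pi fun _ => expMeasure 1) = n := by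
  have h := variance_sum_pi (μ := fun _ : Fin n => expMeasure 1) (X := fun _ x => x)
    fun _ => memLp_exp
  simp only [variance_exp, Finset.sum_const, Finset.card_univ, Fintype.card_fin, nsmul_eq_mul,
    mul_one] at h
  rw [← h]
  congr 1
  ext s
  simp

/-- The moment of order `p` of the sum of `n` independent exponential variables. -/
noncomputable def expSumMoment (p : ℝ) (n : ℕ) : ℝ :=
  ∫ s : Fin n → ℝ, (∑ j, s j) ^ p ∂(Measure.pi fun _ => expMeasure 1)

/-- For exponents in `[0, 1]` the number `y ^ p` lies between `1` and `y`. -/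
lemma abs_rpow_sub_one_le {p y : ℝ} (hp0 : 0 ≤ p) (hp1 : p ≤ 1) (hy : 0 ≤ y) :
    |y ^ p - 1| ≤ |y - 1| := by
  rcases le_total 1 y with h | h
  · have h1 : y ^ p ≤ y := by simpa using Real.rpow_le_rpow_of_exponent_le h hp1
    have h2 : 1 ≤ y ^ p := Real.one_le_rpow h hp0
    rw [abs_of_nonneg (by linarith), abs_of_nonneg (by linarith)]
    linarith
  · have h1 : y ≤ y ^ p := by
      rcases hy.eq_or_lt with rfl | hy
      · positivity
      · simpa using Real.rpow_le_rpow_of_exponent_ge hy h hp1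
    have h2 : y ^ p ≤ 1 := Real.rpow_le_one hy h hp0
    rw [abs_of_nonpos (by linarith), abs_of_nonpos (by linarith)]
    linarith

lemma rpow_le_one_add {p y : ℝ} (hp0 : 0 ≤ p) (hp1 : p ≤ 1) (hy : 0 ≤ y) : y ^ p ≤ 1 + y := by
  rcases le_total 1 y with h | h
  · have h1 : y ^ p ≤ y := by simpa using Real.rpow_le_rpow_of_exponent_le h hp1
    linarith
  · have h2 : y ^ p ≤ 1 := Real.rpow_le_one hy h hp0
    linarith

lemma ae_pi_exp_pos (n : ℕ) :
    ∀ᵐ s ∂(Measure.pi fun _ : Fin n => expMeasure 1), ∀ j, 0 < s j := by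
  rw [ae_all_iff]
  intro j
  exact (measurePreserving_eval (fun _ : Fin n => expMeasure 1) j).quasiMeasurePreserving.ae
    ae_exp_pos

lemma integrable_sum_exp_rpow {p : ℝ} (hp0 : 0 ≤ p) (hp1 : p ≤ 1) (n : ℕ) :
    Integrable (fun s : Fin n → ℝ => (∑ j, s j) ^ p) (Measure.pi fun _ => expMeasure 1) := by
  refine Integrable.mono' ((integrable_const (1 : ℝ)).add
    ((memLp_sum_exp n).integrable (by norm_num))) ?_ ?_
  · exact (Measurable.pow_const (by fun_prop) p).aestronglyMeasurable
  · filter_upwards [ae_pi_exp_pos n] with s hs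
    have h : 0 ≤ ∑ j, s j := Finset.sum_nonneg fun j _ => (hs j).le
    rw [Real.norm_of_nonneg (Real.rpow_nonneg h p)]
    exact rpow_le_one_add hp0 hp1 h

/-- After division by the mean `n`, `abs_rpow_sub_one_le` bounds the error by the mean relative
deviation of the sum, and the standard deviation of the sum is `√n`. -/
lemma abs_expSumMoment_sub_le {p : ℝ} (hp0 : 0 ≤ p) (hp1 : p ≤ 1) {n : ℕ} (hn : 0 < n) :
    |expSumMoment p n / (n : ℝ) ^ p - 1| ≤ 1 / √n := by
  have hn' : (0 : ℝ) < n := by exact_mod_cast hn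
  set μ := Measure.pi fun _ : Fin n => expMeasure 1 with hμ
  have hL2 := memLp_sum_exp n
  have hL1 : Integrable (fun s : Fin n → ℝ => ∑ j, s j) μ := hL2.integrable (by norm_num)
  have hd : MemLp (fun s : Fin n → ℝ => ∑ j, s j - (n : ℝ)) 2 μ := hL2.sub (memLp_const _)
  have h1 : expSumMoment p n / (n : ℝ) ^ p - 1 =
      ∫ s : Fin n → ℝ, ((∑ j, s j) ^ p / (n : ℝ) ^ p - 1) ∂μ := by
    rw [integral_sub ((integrable_sum_exp_rpow hp0 hp1 n).div_const _) (integrable_const _),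
      integral_div]
    simp [expSumMoment]
  have h2 : ∫ s : Fin n → ℝ, |∑ j, s j - (n : ℝ)| ∂μ ≤ √n := by
    have h3 : (∫ s : Fin n → ℝ, |∑ j, s j - (n : ℝ)| ∂μ) ^ 2 ≤ n := by
      -- Nonnegativity of the variance of the absolute deviation serves as the Cauchy–Schwarz
      -- inequality here.
      have h4 := variance_nonneg (fun s : Fin n → ℝ => |∑ j, s j - (n : ℝ)|) μ
      rw [show (fun s : Fin n → ℝ => |∑ j, s j - (n : ℝ)|) = |fun s => ∑ j, s j - (n : ℝ)| from rfl,
        variance_eq_sub hd.abs] at h4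
      have h5 := variance_eq_integral (μ := μ) (X := fun s : Fin n → ℝ => ∑ j, s j)
        hL1.aemeasurable
      rw [variance_sum_exp, integral_sum_exp] at h5
      simp only [Pi.pow_apply, Pi.abs_apply, sq_abs] at h4
      linarith
    exact Real.le_sqrt_of_sq_le h3
  calc |expSumMoment p n / (n : ℝ) ^ p - 1|
      ≤ ∫ s : Fin n → ℝ, |(∑ j, s j) ^ p / (n : ℝ) ^ p - 1| ∂μ := by
        rw [h1]; exact abs_integral_le_integral_abs
    _ ≤ ∫ s : Fin n → ℝ, |∑ j, s j - (n : ℝ)| / n ∂μ := by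
        refine integral_mono_ae ?_ ((hd.integrable (by norm_num)).abs.div_const _) ?_
        · exact (((integrable_sum_exp_rpow hp0 hp1 n).div_const _).sub (integrable_const _)).abs
        · filter_upwards [ae_pi_exp_pos n] with s hs
          have h : 0 ≤ ∑ j, s j := Finset.sum_nonneg fun j _ => (hs j).le
          rw [← Real.div_rpow h hn'.le]
          refine (abs_rpow_sub_one_le hp0 hp1 (by positivity)).trans_eq ?_
          rw [div_sub_one hn'.ne', abs_div, abs_of_pos hn']
    _ ≤ √n / n := by
        rw [integral_div]
        gcongr
    _ = 1 / √n := Real.sqrt_div_self'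

lemma tendsto_expSumMoment {p : ℝ} (hp0 : 0 ≤ p) (hp1 : p ≤ 1) :
    Tendsto (fun n : ℕ => expSumMoment p n / (n : ℝ) ^ p) atTop (𝓝 1) := by
  rw [tendsto_iff_dist_tendsto_zero]
  refine squeeze_zero' (Eventually.of_forall fun _ => dist_nonneg)
    ((eventually_gt_atTop 0).mono fun n hn => abs_expSumMoment_sub_le hp0 hp1 hn) ?_
  have h := (Real.tendsto_sqrt_atTop.comp (tendsto_natCast_atTop_atTop (R := ℝ))).inv_tendsto_atTop
  exact h.congr fun n => by simp

lemma expSumMoment_pos {p : ℝ} (hp0 : 0 ≤ p) (hp1 : p ≤ 1) {n : ℕ} (hn : 0 < n) :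
    0 < expSumMoment p n := by
  have : NeZero n := ⟨hn.ne'⟩
  have hpos : ∀ᵐ s ∂(Measure.pi fun _ : Fin n => expMeasure 1), 0 < (∑ j, s j) ^ p := by
    filter_upwards [ae_pi_exp_pos n] with s hs
    exact Real.rpow_pos_of_pos (Finset.sum_pos (fun j _ => hs j) Finset.univ_nonempty) p
  rw [expSumMoment, integral_pos_iff_support_of_nonneg_ae (hpos.mono fun _ h => h.le)
    (integrable_sum_exp_rpow hp0 hp1 n)]
  have h : (Function.support fun s : Fin n → ℝ => (∑ j, s j) ^ p) =ᵐ[Measure.pi fun _ : Fin n =>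
      expMeasure 1] Set.univ := by
    rw [eventuallyEq_univ]
    filter_upwards [hpos] with s hs using hs.ne'
  rw [measure_congr h]
  simp

/-! ### The spacings of uniform points are normalised exponential spacings -/

/-! ### Products of measures with densities -/

section ProductMeasures

lemma lintegral_prod_fin {n : ℕ} (g : Fin n → ℝ → ENNReal) (hg : ∀ i, Measurable (g i)) :
    ∫⁻ x : Fin n → ℝ, ∏ i, g i (x i) = ∏ i, ∫⁻ x, g i x := by
  induction n with
  | zero => simp [volume_pi]
  | succ n ih =>
    have h := (volume_preserving_piFinSuccAbove (fun _ : Fin (n + 1) => ℝ) 0).lintegral_comp_emb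
      (MeasurableEquiv.measurableEmbedding _) (fun q => g 0 q.1 * ∏ i : Fin n, g i.succ (q.2 i))
    rw [Fin.prod_univ_succ, ← ih (fun i => g i.succ) fun i => hg _,
      ← lintegral_prod_mul (hg 0).aemeasurable
        (Finset.measurable_prod _ fun i _ => (hg i.succ).comp (measurable_pi_apply i)).aemeasurable]
    rw [show (volume : Measure ℝ).prod (volume : Measure (Fin n → ℝ)) = volume from rfl, ← h]
    refine lintegral_congr fun x => ?_
    rw [Fin.prod_univ_succ]
    rfl

lemma pi_withDensity_fin {n : ℕ} {g : ℝ → ENNReal} (hg : Measurable g)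
    [SigmaFinite (volume.withDensity g)] :
    Measure.pi (fun _ : Fin n => volume.withDensity g) =
      volume.withDensity fun x : Fin n → ℝ => ∏ i, g (x i) := by
  refine Measure.pi_eq fun s hs => ?_
  rw [withDensity_apply _ (MeasurableSet.univ_pi hs), ← lintegral_indicator (MeasurableSet.univ_pi hs)]
  have h : ∀ x : Fin n → ℝ, (Set.univ.pi s).indicator (fun x => ∏ i, g (x i)) x =
      ∏ i, (s i).indicator g (x i) := by
    intro x
    by_cases hx : x ∈ Set.univ.pi s
    · rw [Set.indicator_of_mem hx]
      exact Finset.prod_congr rfl fun i _ => (Set.indicator_of_mem (hx i trivial) g).symm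
    · rw [Set.indicator_of_notMem hx]
      simp only [Set.mem_univ_pi, not_forall] at hx
      obtain ⟨i, hi⟩ := hx
      exact (Finset.prod_eq_zero (Finset.mem_univ i) (Set.indicator_of_notMem hi g)).symm
  simp_rw [h]
  rw [lintegral_prod_fin _ fun i => hg.indicator (hs i)]
  refine Finset.prod_congr rfl fun i _ => ?_
  rw [lintegral_indicator (hs i), withDensity_apply _ (hs i)]

lemma pi_const_smul {n : ℕ} (μ : Measure ℝ) [SigmaFinite μ] (c : ENNReal) [SigmaFinite (c • μ)] :
    Measure.pi (fun _ : Fin n => c • μ) = c ^ n • Measure.pi fun _ : Fin n => μ := by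
  refine Measure.pi_eq fun s hs => ?_
  simp [Finset.prod_mul_distrib]

end ProductMeasures

/-- The successive differences of `0, v₀, v₁, …`. -/
def increments (n : ℕ) : (Fin n → ℝ) →ₗ[ℝ] (Fin n → ℝ) where
  toFun v i := v i - (Fin.cons (α := fun _ => ℝ) 0 v : Fin (n + 1) → ℝ) i.castSucc
  map_add' v w := by
    ext i
    rcases Fin.eq_zero_or_eq_succ i.castSucc with h | ⟨k, h⟩
    · simp [h]
    · simp only [h, Fin.cons_succ, Pi.add_apply]; ring
  map_smul' c v := by
    ext i
    rcases Fin.eq_zero_or_eq_succ i.castSucc with h | ⟨k, h⟩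
    · simp [h]
    · simp only [h, Fin.cons_succ, Pi.smul_apply, smul_eq_mul, RingHom.id_apply]; ring

/-- The matrix is lower triangular with unit diagonal. Passing from positions to spacings therefore
preserves Lebesgue measure. -/
lemma det_increments (n : ℕ) : LinearMap.det (increments n) = 1 := by
  rw [← LinearMap.det_toMatrix']
  have hentry : ∀ i j, LinearMap.toMatrix' (increments n) i j = (Pi.single j 1 : Fin n → ℝ) i -
      (Fin.cons (α := fun _ => ℝ) 0 (Pi.single j 1) : Fin (n + 1) → ℝ) i.castSucc := by
    intro i j
    rw [LinearMap.toMatrix'_apply]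
    rfl
  have hzero : ∀ i j : Fin n, i ≤ j →
      (Fin.cons (α := fun _ => ℝ) 0 (Pi.single j 1) : Fin (n + 1) → ℝ) i.castSucc = 0 := by
    intro i j hij
    rcases Fin.eq_zero_or_eq_succ i.castSucc with h | ⟨k, h⟩
    · rw [h, Fin.cons_zero]
    · rw [h, Fin.cons_succ, Pi.single_apply, if_neg]
      rintro rfl
      have := congrArg Fin.val h
      rw [Fin.val_castSucc, Fin.val_succ] at this
      rw [Fin.le_def] at hij
      omega
  rw [Matrix.det_of_isLowerTriangular]
  · refine Finset.prod_eq_one fun i _ => ?_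
    rw [hentry, hzero i i le_rfl]
    simp
  · intro i j hij
    have hij' : i < j := hij
    rw [hentry, hzero i j hij'.le, Pi.single_eq_of_ne hij'.ne, sub_zero]

lemma measurable_increments (n : ℕ) : Measurable (increments n) :=
  (LinearMap.continuous_of_finiteDimensional _).measurable

lemma measurePreserving_increments (n : ℕ) :
    MeasurePreserving (increments n) volume volume := by
  refine ⟨measurable_increments n, ?_⟩
  rw [Real.map_linearMap_volume_pi_eq_smul_volume_pi (by simp [det_increments]), det_increments]
  simp

/-- The spacings of the list `0, u₀, …, uₙ₋₁, L`. -/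
def gaps {n : ℕ} (L : ℝ) (u : Fin n → ℝ) : Fin (n + 1) → ℝ :=
  increments (n + 1) (Fin.snoc (α := fun _ => ℝ) u L)

lemma spacings_eq_gaps {n : ℕ} (L : ℝ) (u : Fin n → ℝ) :
    spacings L u = gaps L (u ∘ Tuple.sort u) := by
  ext i
  simp [spacings, gaps, increments]

lemma gaps_smul {n : ℕ} (c L : ℝ) (u : Fin n → ℝ) : gaps (c * L) (c • u) = c • gaps L u := by
  rw [gaps, gaps, ← map_smul]
  congr 1
  ext i
  refine Fin.lastCases ?_ (fun j => ?_) i <;> simp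

lemma measurable_gaps {n : ℕ} : Measurable fun q : ℝ × (Fin n → ℝ) => gaps q.1 q.2 := by
  refine (measurable_increments _).comp (measurable_pi_lambda _ fun i => ?_)
  refine Fin.lastCases ?_ (fun j => ?_) i
  · simpa using measurable_fst
  · simp only [Fin.snoc_castSucc]
    exact (measurable_pi_apply j).comp measurable_snd

lemma sum_gaps {n : ℕ} (L : ℝ) (u : Fin n → ℝ) : ∑ i, gaps L u i = L := by
  set v : Fin (n + 1) → ℝ := Fin.snoc (α := fun _ => ℝ) u L with hv
  have h1 := Fin.sum_univ_succ (Fin.cons (α := fun _ => ℝ) 0 v : Fin (n + 2) → ℝ)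
  have h2 := Fin.sum_univ_castSucc (Fin.cons (α := fun _ => ℝ) 0 v : Fin (n + 2) → ℝ)
  simp only [Fin.cons_zero, Fin.cons_succ, zero_add, ← Fin.succ_last] at h1 h2
  have h3 : ∑ i, gaps L u i = ∑ i, v i -
      ∑ i, (Fin.cons (α := fun _ => ℝ) 0 v : Fin (n + 2) → ℝ) (Fin.castSucc i) := by
    rw [← Finset.sum_sub_distrib]
    rfl
  have h4 : v (Fin.last n) = L := by simp [hv]
  linarith

lemma gaps_nonneg_iff {n : ℕ} {L : ℝ} (hL : 0 ≤ L) (u : Fin n → ℝ) :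
    (∀ i, 0 ≤ gaps L u i) ↔ Monotone u ∧ ∀ i, u i ∈ Set.Icc 0 L := by
  set v : Fin (n + 1) → ℝ := Fin.snoc (α := fun _ => ℝ) u L with hv
  set x : Fin (n + 2) → ℝ := Fin.cons (α := fun _ => ℝ) 0 v with hx
  have hxu : ∀ i : Fin n, x i.castSucc.succ = u i := fun i => by simp [hx, hv]
  have hx0 : x 0 = 0 := by simp [hx]
  have hxL : x (Fin.last (n + 1)) = L := by simp [hx, hv, ← Fin.succ_last]
  have hmono : (∀ i, 0 ≤ gaps L u i) ↔ Monotone x := by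
    rw [Fin.monotone_iff_le_succ]
    refine forall_congr' fun i => ?_
    change 0 ≤ x i.succ - x i.castSucc ↔ _
    exact sub_nonneg
  rw [hmono]
  constructor
  · intro h
    refine ⟨fun i j hij => ?_, fun i => ⟨?_, ?_⟩⟩
    · rw [← hxu, ← hxu]
      exact h (Fin.succ_le_succ_iff.2 (Fin.castSucc_le_castSucc_iff.2 hij))
    · rw [← hxu, ← hx0]
      exact h (Fin.zero_le _)
    · rw [← hxu, ← hxL]
      exact h (Fin.le_last _)
  · rintro ⟨h1, h2⟩ a b hab
    have hcases : ∀ a, a = 0 ∨ a = Fin.last (n + 1) ∨ ∃ i : Fin n, a = i.castSucc.succ := by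
      intro a
      rcases Fin.eq_zero_or_eq_succ a with h | ⟨k, rfl⟩
      · exact Or.inl h
      · rcases Fin.eq_castSucc_or_eq_last k with ⟨j, rfl⟩ | rfl
        · exact Or.inr (Or.inr ⟨j, rfl⟩)
        · exact Or.inr (Or.inl (Fin.succ_last _))
    rcases hcases a with rfl | rfl | ⟨i, rfl⟩
    · rcases hcases b with rfl | rfl | ⟨j, rfl⟩
      · exact le_rfl
      · rw [hx0, hxL]; exact hL
      · rw [hx0, hxu]; exact (h2 j).1
    · rw [Fin.last_le_iff.1 hab]
    · rcases hcases b with rfl | rfl | ⟨j, rfl⟩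
      · exact absurd hab (by simp)
      · rw [hxu, hxL]; exact (h2 i).2
      · rw [hxu, hxu]
        exact h1 (Fin.castSucc_le_castSucc_iff.1 (Fin.succ_le_succ_iff.1 hab))

/-- Ties occur on finitely many proper subspaces, which are null. -/
lemma ae_injective {n : ℕ} : ∀ᵐ u : Fin n → ℝ, Function.Injective u := by
  have h : ∀ᵐ u : Fin n → ℝ, ∀ i j, i ≠ j → u i ≠ u j := by
    simp_rw [ae_all_iff]
    intro i j hij
    have h0 := Measure.addHaar_submodule (volume : Measure (Fin n → ℝ))
      (LinearMap.ker (LinearMap.proj (R := ℝ) (φ := fun _ : Fin n => ℝ) i - LinearMap.proj j)) (by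
        intro htop
        have h1 : (Pi.single i 1 : Fin n → ℝ) ∈ LinearMap.ker
            (LinearMap.proj (R := ℝ) (φ := fun _ : Fin n => ℝ) i - LinearMap.proj j) := by
          rw [htop]; trivial
        simp [LinearMap.mem_ker, hij.symm] at h1)
    refine measure_mono_null (fun u hu => ?_) h0
    simp only [Set.mem_compl_iff, Set.mem_ofPred_eq, not_not] at hu
    simp [LinearMap.mem_ker, hu]
  filter_upwards [h] with u hu i j hij
  by_contra hne
  exact hu i j hne hij

lemma lintegral_comp_perm {n : ℕ} (τ : Equiv.Perm (Fin n)) (G : (Fin n → ℝ) → ENNReal) :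
    ∫⁻ u, G (u ∘ τ) = ∫⁻ u, G u := by
  have h := (volume_measurePreserving_piCongrLeft (fun _ : Fin n => ℝ) τ).lintegral_comp_emb
    (MeasurableEquiv.measurableEmbedding _) (fun u => G (u ∘ τ))
  rw [← h]
  refine lintegral_congr fun u => congrArg G ?_
  ext i
  exact (Equiv.piCongrLeft_apply_apply (fun _ : Fin n => ℝ) τ u i)

/-- Symmetrisation: integrating over the sorted list. -/
lemma lintegral_comp_sort {n : ℕ} {G : (Fin n → ℝ) → ENNReal} (hG : Measurable G)
    (hmono : ∀ u, G u ≠ 0 → Monotone u) :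
    ∫⁻ u : Fin n → ℝ, G (u ∘ Tuple.sort u) = n.factorial * ∫⁻ u, G u := by
  -- Without ties exactly one permutation sorts the list, and `G` vanishes on every unsorted
  -- rearrangement.
  have h : ∀ᵐ u : Fin n → ℝ, G (u ∘ Tuple.sort u) = ∑ τ : Equiv.Perm (Fin n), G (u ∘ τ) := by
    filter_upwards [ae_injective] with u hu
    rw [Finset.sum_eq_single (Tuple.sort u)]
    · intro τ _ hτ
      by_contra hne
      have h1 := Tuple.unique_monotone (hmono _ hne) (Tuple.monotone_sort u)
      exact hτ (Equiv.ext fun i => hu (congrFun h1 i))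
    · simp
  rw [lintegral_congr_ae h, lintegral_finsetSum]
  · simp_rw [lintegral_comp_perm]
    simp [Fintype.card_perm]
  · intro τ _
    exact hG.comp (measurable_pi_lambda _ fun i => measurable_pi_apply _)

/-! ### Homogeneous functions of exponential and of uniform spacings -/

section Comparison

variable {n : ℕ} {F : (Fin (n + 1) → ℝ) → ENNReal}

open Classical in
/-- The restriction of `F` to lists of nonnegative spacings, in terms of the positions. -/
noncomputable def onSimplex (F : (Fin (n + 1) → ℝ) → ENNReal) (T : ℝ) (u : Fin n → ℝ) : ENNReal :=
  if ∀ i, 0 ≤ gaps T u i then F (gaps T u) else 0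

lemma measurable_onSimplex (hF : Measurable F) :
    Measurable fun q : ℝ × (Fin n → ℝ) => onSimplex F q.1 q.2 := by
  classical
  refine Measurable.ite ?_ (hF.comp measurable_gaps) measurable_const
  rw [show {q : ℝ × (Fin n → ℝ) | ∀ i, 0 ≤ gaps q.1 q.2 i} =
    ⋂ i, {q : ℝ × (Fin n → ℝ) | 0 ≤ gaps q.1 q.2 i} by ext; simp]
  exact MeasurableSet.iInter fun i =>
    measurableSet_le measurable_const ((measurable_pi_apply i).comp measurable_gaps)

lemma measurable_onSimplex_right (hF : Measurable F) (T : ℝ) : Measurable (onSimplex F T) :=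
  (measurable_onSimplex hF).comp measurable_prodMk_left

lemma onSimplex_of_neg {T : ℝ} (hT : T < 0) (u : Fin n → ℝ) : onSimplex F T u = 0 := by
  rw [onSimplex, if_neg]
  intro h
  have := Finset.sum_nonneg fun i (_ : i ∈ Finset.univ) => h i
  rw [sum_gaps] at this
  linarith

/-- Rescaling the positions by `T / L` produces the power `n` as Jacobian and the power `p` from the
homogeneity of `F`. -/
lemma lintegral_onSimplex_scale {p : ℝ} (hF : Measurable F)
    (hhom : ∀ c : ℝ, 0 < c → ∀ s, F (c • s) = ENNReal.ofReal (c ^ p) * F s)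
    {T L : ℝ} (hT : 0 < T) (hL : 0 < L) :
    ∫⁻ u, onSimplex F T u =
      ENNReal.ofReal ((T / L) ^ n * (T / L) ^ p) * ∫⁻ u, onSimplex F L u := by
  set c := T / L with hc
  have hc0 : 0 < c := div_pos hT hL
  have hcL : c * L = T := div_mul_cancel₀ _ hL.ne'
  have h1 : ∀ u, onSimplex F T (c • u) = ENNReal.ofReal (c ^ p) * onSimplex F L u := by
    intro u
    have h2 : (∀ i, 0 ≤ gaps T (c • u) i) ↔ ∀ i, 0 ≤ gaps L u i := by
      rw [← hcL, gaps_smul]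
      simp [hc0]
    rw [onSimplex, onSimplex]
    by_cases h : ∀ i, 0 ≤ gaps L u i
    · rw [if_pos h, if_pos (h2.2 h), ← hhom c hc0, ← hcL, gaps_smul]
    · rw [if_neg h, if_neg (mt h2.1 h), mul_zero]
  have h3 := Measure.map_addHaar_smul (volume : Measure (Fin n → ℝ)) hc0.ne'
  have h4 : ∫⁻ u, onSimplex F T (c • u) =
      ENNReal.ofReal (c ^ n)⁻¹ * ∫⁻ u, onSimplex F T u := by
    rw [← lintegral_map (measurable_onSimplex_right hF T) (measurable_const_smul c), h3,
      lintegral_smul_measure]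
    simp [abs_of_pos hc0]
  simp_rw [h1] at h4
  rw [lintegral_const_mul _ (measurable_onSimplex_right hF L)] at h4
  rw [ENNReal.ofReal_mul (by positivity), mul_assoc, h4, ← mul_assoc, ← ENNReal.ofReal_mul
    (by positivity), mul_inv_cancel₀ (by positivity), ENNReal.ofReal_one, one_mul]

open Classical in
-- The joint density of the spacings is `exp (-T)`, a function of the total length `T` alone. In
-- terms of positions, `T` is the last coordinate, and for fixed `T` the other positions carry
-- Lebesgue measure on a simplex.
lemma lintegral_pi_exp (hF : Measurable F) :
    ∫⁻ s, F s ∂(Measure.pi fun _ : Fin (n + 1) => expMeasure 1) =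
      ∫⁻ T, ENNReal.ofReal (Real.exp (-T)) * ∫⁻ u, onSimplex F T u := by
  set g : ℝ → ENNReal := (Set.Ici (0 : ℝ)).indicator fun x => ENNReal.ofReal (Real.exp (-x)) with hg
  have hgm : Measurable g := Measurable.indicator (by fun_prop) measurableSet_Ici
  have : SigmaFinite (volume.withDensity g) := by
    rw [hg, ← expMeasure_one]; infer_instance
  have hD : ∀ s : Fin (n + 1) → ℝ, ∏ i, g (s i) =
      if ∀ i, 0 ≤ s i then ENNReal.ofReal (Real.exp (-∑ i, s i)) else 0 := by
    intro s
    split_ifs with h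
    · rw [← Finset.sum_neg_distrib, Real.exp_sum, ENNReal.ofReal_prod_of_nonneg
        fun i _ => (Real.exp_pos _).le]
      exact Finset.prod_congr rfl fun i _ => Set.indicator_of_mem (Set.mem_Ici.2 (h i)) _
    · simp only [not_forall] at h
      obtain ⟨i, hi⟩ := h
      exact Finset.prod_eq_zero (Finset.mem_univ i) (Set.indicator_of_notMem hi _)
  have hDm : Measurable fun s : Fin (n + 1) → ℝ => ∏ i, g (s i) :=
    Finset.measurable_prod _ fun i _ => hgm.comp (measurable_pi_apply i)
  rw [expMeasure_one, ← hg, pi_withDensity_fin hgm, lintegral_withDensity_eq_lintegral_mul _ hDm hF,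
    ← (measurePreserving_increments (n + 1)).lintegral_comp (hDm.mul hF),
    ← (volume_preserving_piFinSuccAbove (fun _ : Fin (n + 1) => ℝ) (Fin.last n)).symm.lintegral_comp
      (f := fun v => ((fun s : Fin (n + 1) → ℝ => ∏ i, g (s i)) * F) (increments (n + 1) v))
      ((hDm.mul hF).comp (measurable_increments _))]
  have hpt : ∀ q : ℝ × (Fin n → ℝ), ((fun s : Fin (n + 1) → ℝ => ∏ i, g (s i)) * F)
      (increments (n + 1) ((MeasurableEquiv.piFinSuccAbove (fun _ => ℝ) (Fin.last n)).symm q)) =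
      ENNReal.ofReal (Real.exp (-q.1)) * onSimplex F q.1 q.2 := by
    intro q
    have h1 : increments (n + 1)
        ((MeasurableEquiv.piFinSuccAbove (fun _ => ℝ) (Fin.last n)).symm q) = gaps q.1 q.2 := by
      rw [gaps, ← Fin.insertNth_last']
      rfl
    rw [h1, Pi.mul_apply, hD, onSimplex, sum_gaps]
    split_ifs <;> simp
  simp_rw [hpt]
  have hm : Measurable fun q : ℝ × (Fin n → ℝ) =>
      ENNReal.ofReal (Real.exp (-q.1)) * onSimplex F q.1 q.2 :=
    Measurable.mul (by fun_prop) (measurable_onSimplex hF)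
  rw [show (volume : Measure (ℝ × (Fin n → ℝ))) = volume.prod volume from rfl,
    lintegral_prod _ hm.aemeasurable]
  exact lintegral_congr fun T => lintegral_const_mul (ENNReal.ofReal (Real.exp (-T)))
    (measurable_onSimplex_right hF T)

/-- The law of the spacings of `n` independent uniform points of `[0, L]`. -/
noncomputable def uniformSpacings (n : ℕ) (L : ℝ) : Measure (Fin (n + 1) → ℝ) :=
  (Measure.pi fun _ : Fin n => ProbabilityTheory.cond volume (Set.Icc (0 : ℝ) L)).map (spacings L)

/-- Sorting folds the cube `[0, L] ^ n` onto the simplex of ordered positions, covering it `n!`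
times up to a null set. -/
lemma lintegral_uniformSpacings (hF : Measurable F) {L : ℝ} (hL : 0 < L) :
    ∫⁻ s, F s ∂(uniformSpacings n L) =
      (ENNReal.ofReal L)⁻¹ ^ n * n.factorial * ∫⁻ u, onSimplex F L u := by
  have hcond : (fun _ : Fin n => ProbabilityTheory.cond volume (Set.Icc (0 : ℝ) L)) =
      fun _ => (ENNReal.ofReal L)⁻¹ • volume.restrict (Set.Icc (0 : ℝ) L) := by
    ext1 i
    rw [ProbabilityTheory.cond, Real.volume_Icc, sub_zero]
  have : SigmaFinite ((ENNReal.ofReal L)⁻¹ • volume.restrict (Set.Icc (0 : ℝ) L)) := by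
    have h : ProbabilityTheory.cond volume (Set.Icc (0 : ℝ) L) =
      (ENNReal.ofReal L)⁻¹ • volume.restrict (Set.Icc (0 : ℝ) L) := by
      rw [ProbabilityTheory.cond, Real.volume_Icc, sub_zero]
    rw [← h]
    infer_instance
  rw [uniformSpacings, lintegral_map hF (measurable_spacings L), hcond, pi_const_smul,
    lintegral_smul_measure, ← Measure.restrict_pi_pi, ← volume_pi, smul_eq_mul, mul_assoc,
    ← lintegral_comp_sort (measurable_onSimplex_right hF L),
    ← lintegral_indicator (MeasurableSet.univ_pi fun _ => measurableSet_Icc)]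
  · congr 1
    refine lintegral_congr fun u => ?_
    have hiff : (∀ i, 0 ≤ gaps L (u ∘ Tuple.sort u) i) ↔
        u ∈ Set.univ.pi fun _ => Set.Icc (0 : ℝ) L := by
      rw [gaps_nonneg_iff hL.le, Set.mem_univ_pi]
      refine ⟨fun h i => ?_, fun h => ⟨Tuple.monotone_sort u, fun i => h _⟩⟩
      simpa using h.2 ((Tuple.sort u).symm i)
    rw [onSimplex]
    by_cases h : u ∈ Set.univ.pi fun _ => Set.Icc (0 : ℝ) L
    · rw [Set.indicator_of_mem h, if_pos (hiff.2 h), spacings_eq_gaps]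
    · rw [Set.indicator_of_notMem h, if_neg (mt hiff.1 h)]
  · intro u hu
    rw [onSimplex] at hu
    by_contra hne
    refine hu (if_neg fun h => hne ((gaps_nonneg_iff hL.le u).1 h).1)

/-- By `lintegral_onSimplex_scale` the integral over `T` splits off as a factor. What matters is
that `K` is chosen before `F`: its value need not be computed, since one test function determines
it. -/
lemma exists_lintegral_pi_exp_eq (n : ℕ) (p : ℝ) {L : ℝ} (hL : 0 < L) :
    ∃ K : ENNReal, ∀ F : (Fin (n + 1) → ℝ) → ENNReal, Measurable F →
      (∀ c : ℝ, 0 < c → ∀ s, F (c • s) = ENNReal.ofReal (c ^ p) * F s) →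
      ∫⁻ s, F s ∂(Measure.pi fun _ : Fin (n + 1) => expMeasure 1) =
        K * ∫⁻ s, F s ∂(uniformSpacings n L) := by
  set K₀ := ∫⁻ T in Set.Ioi 0, ENNReal.ofReal (Real.exp (-T)) *
    ENNReal.ofReal ((T / L) ^ n * (T / L) ^ p) with hK₀
  set C : ENNReal := (ENNReal.ofReal L)⁻¹ ^ n * n.factorial with hC
  have hC0 : C ≠ 0 := by
    simp [hC, Nat.factorial_ne_zero]
  have hCt : C ≠ ⊤ := by
    refine ENNReal.mul_ne_top (ENNReal.pow_ne_top ?_) (ENNReal.natCast_ne_top _)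
    simpa using hL
  refine ⟨K₀ * C⁻¹, fun F hF hhom => ?_⟩
  rw [lintegral_uniformSpacings hF hL, ← hC, mul_assoc, ← mul_assoc C⁻¹, ENNReal.inv_mul_cancel hC0 hCt,
    one_mul, lintegral_pi_exp hF]
  -- Nonnegative spacings have a nonnegative total, so negative `T` contribute nothing; the null
  -- point `T = 0` is dropped afterwards because the scaling needs `T > 0`.
  have hIci : ∫⁻ T, ENNReal.ofReal (Real.exp (-T)) * ∫⁻ u, onSimplex F T u =
      ∫⁻ T in Set.Ici 0, ENNReal.ofReal (Real.exp (-T)) * ∫⁻ u, onSimplex F T u := by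
    rw [← lintegral_indicator measurableSet_Ici]
    refine lintegral_congr fun T => ?_
    by_cases h : 0 ≤ T
    · rw [Set.indicator_of_mem (Set.mem_Ici.2 h)]
    · rw [Set.indicator_of_notMem (by simpa using h)]
      simp [onSimplex_of_neg (not_le.1 h)]
  rw [hIci, ← restrict_Ioi_eq_restrict_Ici, hK₀, ← lintegral_mul_const'']
  · refine setLIntegral_congr_fun measurableSet_Ioi fun T hT => ?_
    rw [lintegral_onSimplex_scale hF hhom hT hL, mul_assoc]
  · refine Measurable.aemeasurable ?_
    have h1 : Measurable fun T : ℝ => (T / L) ^ p := (measurable_id.div_const L).pow_const p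
    fun_prop

end Comparison

/-! ### The expected cost of an arc in the three models -/

lemma abs_position_sub {n : ℕ} (s : Fin (n + 1) → ℝ) {i j : Fin n} (hij : i < j) :
    |position s i - position s j| = |∑ l ∈ Finset.Ioc i.castSucc j.castSucc, s l| := by
  have h : Finset.Iic j.castSucc = Finset.Iic i.castSucc ∪ Finset.Ioc i.castSucc j.castSucc := by
    ext l
    have := Fin.castSucc_lt_castSucc_iff.2 hij
    simp only [Finset.mem_Iic, Finset.mem_union, Finset.mem_Ioc]
    constructor
    · intro hl
      rcases le_or_gt l i.castSucc with h | h
      · exact Or.inl h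
      · exact Or.inr ⟨h, hl⟩
    · rintro (h | h)
      · exact h.trans this.le
      · exact h.2
  have hd : Disjoint (Finset.Iic i.castSucc) (Finset.Ioc i.castSucc j.castSucc) := by
    rw [Finset.disjoint_left]
    intro l hl hl'
    exact not_lt.2 (Finset.mem_Iic.1 hl) (Finset.mem_Ioc.1 hl').1
  rw [abs_sub_comm, position, position, h, Finset.sum_union hd, add_sub_cancel_left]

lemma card_Ioc_castSucc {n : ℕ} (i j : Fin n) :
    (Finset.Ioc i.castSucc j.castSucc).card = j - i := by simp

/-! ### Arc costs for exponential spacings -/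

section Exponential

variable {p : ℝ} {ι : Type*} [Fintype ι]

lemma identDistrib_abs_sum_rpow (A : Finset ι) :
    IdentDistrib (fun s : ι → ℝ => |∑ l ∈ A, s l| ^ p)
      (fun s : Fin A.card → ℝ => |∑ l, s l| ^ p)
      (Measure.pi fun _ => expMeasure 1) (Measure.pi fun _ => expMeasure 1) :=
  (identDistrib_sum_pi (expMeasure 1) A rfl).comp (u := fun x : ℝ => |x| ^ p)
    (measurable_id.abs.pow_const p)

lemma abs_sum_rpow_ae_eq (p : ℝ) (n : ℕ) :
    (fun s : Fin n → ℝ => |∑ l, s l| ^ p) =ᵐ[Measure.pi fun _ => expMeasure 1]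
      fun s => (∑ l, s l) ^ p := by
  filter_upwards [ae_pi_exp_pos n] with s hs
  rw [abs_of_nonneg (Finset.sum_nonneg fun l _ => (hs l).le)]

lemma integrable_abs_sum_exp_rpow (hp0 : 0 ≤ p) (hp1 : p ≤ 1) (A : Finset ι) :
    Integrable (fun s : ι → ℝ => |∑ l ∈ A, s l| ^ p) (Measure.pi fun _ => expMeasure 1) :=
  (identDistrib_abs_sum_rpow A).integrable_iff.2
    ((integrable_sum_exp_rpow hp0 hp1 _).congr (abs_sum_rpow_ae_eq p _).symm)

lemma integral_abs_sum_exp_rpow (A : Finset ι) :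
    ∫ s : ι → ℝ, |∑ l ∈ A, s l| ^ p ∂(Measure.pi fun _ => expMeasure 1) =
      expSumMoment p A.card := by
  rw [(identDistrib_abs_sum_rpow A).integral_eq, integral_congr_ae (abs_sum_rpow_ae_eq p _),
    expSumMoment]

lemma lintegral_abs_sum_exp_rpow (hp0 : 0 ≤ p) (hp1 : p ≤ 1) (A : Finset ι) :
    ∫⁻ s : ι → ℝ, ENNReal.ofReal (|∑ l ∈ A, s l| ^ p) ∂(Measure.pi fun _ => expMeasure 1) =
      ENNReal.ofReal (expSumMoment p A.card) := by
  rw [← integral_abs_sum_exp_rpow, ofReal_integral_eq_lintegral_ofReal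
    (integrable_abs_sum_exp_rpow hp0 hp1 A) (Eventually.of_forall fun s => by positivity)]

end Exponential

/-! ### Arc costs for spacings of uniform points -/

section Uniform

variable {p : ℝ} {n : ℕ} {L : ℝ}

lemma isProbabilityMeasure_uniformSpacings (hL : 0 < L) :
    IsProbabilityMeasure (uniformSpacings n L) := by
  have : IsProbabilityMeasure (ProbabilityTheory.cond volume (Set.Icc (0 : ℝ) L)) := by
    refine cond_isProbabilityMeasure_of_finite ?_ ?_
    · simpa using hL
    · simp
  exact Measure.isProbabilityMeasure_map (measurable_spacings L).aemeasurable

/-- The comparison constant `K` is applied twice, to the set `A` and to the set of all spacings. The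
latter sum to `L` identically, which gives `K = expSumMoment p (n + 1) / L ^ p`. -/
lemma lintegral_abs_sum_uniformSpacings (hp0 : 0 ≤ p) (hp1 : p ≤ 1) (hL : 0 < L)
    (A : Finset (Fin (n + 1))) :
    ∫⁻ s, ENNReal.ofReal (|∑ l ∈ A, s l| ^ p) ∂(uniformSpacings n L) =
      ENNReal.ofReal (L ^ p / expSumMoment p (n + 1) * expSumMoment p A.card) := by
  have := isProbabilityMeasure_uniformSpacings (n := n) hL
  obtain ⟨K, hK⟩ := exists_lintegral_pi_exp_eq n p hL
  have hmeas : ∀ A : Finset (Fin (n + 1)),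
      Measurable fun s : Fin (n + 1) → ℝ => ENNReal.ofReal (|∑ l ∈ A, s l| ^ p) := by
    intro A
    refine ENNReal.measurable_ofReal.comp (Measurable.pow_const ?_ p)
    exact (Finset.measurable_fun_sum A fun l _ => measurable_pi_apply l).abs
  have hhom : ∀ A : Finset (Fin (n + 1)), ∀ c : ℝ, 0 < c → ∀ s : Fin (n + 1) → ℝ,
      ENNReal.ofReal (|∑ l ∈ A, (c • s) l| ^ p) =
        ENNReal.ofReal (c ^ p) * ENNReal.ofReal (|∑ l ∈ A, s l| ^ p) := by
    intro A c hc s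
    rw [← ENNReal.ofReal_mul (by positivity), ← Real.mul_rpow hc.le (abs_nonneg _)]
    simp only [Pi.smul_apply, smul_eq_mul, ← Finset.mul_sum, abs_mul, abs_of_pos hc]
  have hA := hK _ (hmeas A) (hhom A)
  have hU := hK _ (hmeas Finset.univ) (hhom Finset.univ)
  rw [lintegral_abs_sum_exp_rpow hp0 hp1] at hA hU
  have htot : ∫⁻ s : Fin (n + 1) → ℝ, ENNReal.ofReal (|∑ l, s l| ^ p) ∂(uniformSpacings n L) =
      ENNReal.ofReal (L ^ p) := by
    rw [uniformSpacings, lintegral_map (hmeas Finset.univ) (measurable_spacings L)]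
    simp_rw [spacings_eq_gaps, sum_gaps, abs_of_pos hL]
    rw [lintegral_const]
    have : IsProbabilityMeasure (ProbabilityTheory.cond volume (Set.Icc (0 : ℝ) L)) := by
      refine cond_isProbabilityMeasure_of_finite ?_ ?_
      · simpa using hL
      · simp
    simp
  rw [htot, Finset.card_univ, Fintype.card_fin] at hU
  set m := expSumMoment p (n + 1) with hm
  have hm0 : 0 < m := expSumMoment_pos hp0 hp1 (Nat.succ_pos n)
  have hLp : 0 < L ^ p := Real.rpow_pos_of_pos hL p
  have hKeq : ENNReal.ofReal (L ^ p / m) * K = 1 := by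
    have h1 : ENNReal.ofReal (L ^ p / m) = ENNReal.ofReal (L ^ p) * (ENNReal.ofReal m)⁻¹ := by
      rw [ENNReal.ofReal_div_of_pos hm0, div_eq_mul_inv]
    rw [h1, mul_right_comm, mul_comm _ K, ← hU]
    exact ENNReal.mul_inv_cancel (by simpa using hm0) ENNReal.ofReal_ne_top
  rw [ENNReal.ofReal_mul (by positivity), hA, ← mul_assoc, hKeq, one_mul]

lemma integrable_abs_sum_uniformSpacings (hp0 : 0 ≤ p) (hp1 : p ≤ 1) (hL : 0 < L)
    (A : Finset (Fin (n + 1))) :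
    Integrable (fun s => |∑ l ∈ A, s l| ^ p) (uniformSpacings n L) := by
  have hm : Measurable fun s : Fin (n + 1) → ℝ => |∑ l ∈ A, s l| ^ p :=
    Measurable.pow_const (Finset.measurable_fun_sum A fun l _ => measurable_pi_apply l).abs p
  rw [← lintegral_ofReal_ne_top_iff_integrable hm.aestronglyMeasurable
    (Eventually.of_forall fun s => by positivity), lintegral_abs_sum_uniformSpacings hp0 hp1 hL]
  exact ENNReal.ofReal_ne_top

lemma expSumMoment_nonneg (hp0 : 0 ≤ p) (hp1 : p ≤ 1) (n : ℕ) : 0 ≤ expSumMoment p n := by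
  rcases Nat.eq_zero_or_pos n with rfl | hn
  · simp only [expSumMoment, Finset.univ_eq_empty, Finset.sum_empty]
    exact integral_nonneg fun _ => Real.rpow_nonneg le_rfl p
  · exact (expSumMoment_pos hp0 hp1 hn).le

lemma integral_abs_sum_uniformSpacings (hp0 : 0 ≤ p) (hp1 : p ≤ 1) (hL : 0 < L)
    (A : Finset (Fin (n + 1))) :
    ∫ s, |∑ l ∈ A, s l| ^ p ∂(uniformSpacings n L) =
      L ^ p / expSumMoment p (n + 1) * expSumMoment p A.card := by
  have h1 := expSumMoment_nonneg hp0 hp1 (n + 1)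
  have h2 := expSumMoment_nonneg hp0 hp1 A.card
  rw [integral_eq_lintegral_of_nonneg_ae (Eventually.of_forall fun s => by positivity)
    (integrable_abs_sum_uniformSpacings hp0 hp1 hL A).aestronglyMeasurable,
    lintegral_abs_sum_uniformSpacings hp0 hp1 hL, ENNReal.toReal_ofReal (by positivity)]

end Uniform

/-- In each model the mean cost of an arc is, up to a factor tending to one, a function of its
length `l` that is equivalent to `l ^ p`. -/
lemma exists_arc_moments (M : Model) {p : ℝ} (hp0 : 0 ≤ p) (hp1 : p ≤ 1) :
    ∃ g φ : ℕ → ℝ, Tendsto g atTop (𝓝 1) ∧ (∀ l, 0 < l → 0 < φ l) ∧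
      Tendsto (fun l : ℕ => φ l / (l : ℝ) ^ p) atTop (𝓝 1) ∧
      ∀ (N : ℕ) (i j : Fin (2 * N)), i < j →
        Integrable (fun s => |position s i - position s j| ^ p) (spacingLaw M N) ∧
        ∫ s, |position s i - position s j| ^ p ∂(spacingLaw M N) = g N * φ (j - i) := by
  cases M with
  | ES =>
    refine ⟨fun _ => 1, expSumMoment p, tendsto_const_nhds, fun l => expSumMoment_pos hp0 hp1,
      tendsto_expSumMoment hp0 hp1, fun N i j hij => ?_⟩
    simp_rw [abs_position_sub _ hij]
    refine ⟨integrable_abs_sum_exp_rpow hp0 hp1 _, ?_⟩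
    rw [spacingLaw, integral_abs_sum_exp_rpow, card_Ioc_castSucc, one_mul]
  | US =>
    refine ⟨fun _ => 1, fun l => (l : ℝ) ^ p, tendsto_const_nhds, fun l hl => by positivity, ?_,
      fun N i j hij => ?_⟩
    · refine tendsto_const_nhds.congr' ((eventually_gt_atTop 0).mono fun l hl => ?_)
      exact (div_self (by positivity)).symm
    · simp_rw [abs_position_sub _ hij]
      have hm : Measurable fun s : Fin (2 * N + 1) → ℝ =>
          |∑ l ∈ Finset.Ioc i.castSucc j.castSucc, s l| ^ p :=
        Measurable.pow_const (Finset.measurable_fun_sum _ fun l _ => measurable_pi_apply l).abs p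
      rw [spacingLaw]
      refine ⟨integrable_dirac enorm_lt_top, ?_⟩
      rw [integral_dirac' _ _ hm.stronglyMeasurable]
      simp only [Finset.sum_const, card_Ioc_castSucc, nsmul_eq_mul, mul_one, one_mul, Nat.abs_cast]
  | PPP =>
    refine ⟨fun N => (2 * N + 1 : ℝ) ^ p / expSumMoment p (2 * N + 1), expSumMoment p, ?_,
      fun l => expSumMoment_pos hp0 hp1, tendsto_expSumMoment hp0 hp1, fun N i j hij => ?_⟩
    -- The interval has length `2 * N + 1`, equal to the mean of the sum of all `2 * N + 1`
    -- exponential spacings, so the normalising factor tends to one.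
    · have h := ((tendsto_expSumMoment hp0 hp1).comp (tendsto_atTop_mono
        (fun N : ℕ => (by omega : N ≤ 2 * N + 1)) tendsto_id)).inv₀ one_ne_zero
      rw [inv_one] at h
      refine h.congr fun N => ?_
      simp
    · have hL : (0 : ℝ) < 2 * N + 1 := by positivity
      simp_rw [abs_position_sub _ hij]
      refine ⟨integrable_abs_sum_uniformSpacings hp0 hp1 hL _, ?_⟩
      have h := integral_abs_sum_uniformSpacings (n := 2 * N) hp0 hp1 hL
        (Finset.Ioc i.castSucc j.castSucc)
      rw [card_Ioc_castSucc] at h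
      exact h

/-! ### Asymptotics of the central binomial coefficients -/

/-- The return probability `4⁻ⁿ * (2n choose n)` of the simple random walk. -/
noncomputable def returnProb (n : ℕ) : ℝ := n.centralBinom / 4 ^ n

lemma returnProb_pos (n : ℕ) : 0 < returnProb n :=
  div_pos (by exact_mod_cast n.centralBinom_pos) (by positivity)

/-- Inserting Stirling's normalisation into `(2 * n)! / n! ^ 2` cancels all powers of `n`, `exp 1`
and `4`, leaving a quotient that tends to `√π / π`. -/
lemma returnProb_mul_sqrt (n : ℕ) (hn : n ≠ 0) :
    returnProb n * √n = Stirling.stirlingSeq (2 * n) / Stirling.stirlingSeq n ^ 2 := by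
  have hfac := Nat.choose_mul_factorial_mul_factorial (show n ≤ 2 * n by omega)
  rw [← Nat.centralBinom_eq_two_mul_choose, show 2 * n - n = n by omega] at hfac
  have hfac' : (n.centralBinom : ℝ) * n.factorial * n.factorial = (2 * n).factorial := by
    exact_mod_cast hfac
  have hn' : (0 : ℝ) < n := by exact_mod_cast Nat.pos_of_ne_zero hn
  have hs : √(2 * ((2 * n : ℕ) : ℝ)) = 2 * √n := by
    rw [show (2 * ((2 * n : ℕ) : ℝ)) = 2 ^ 2 * n by push_cast; ring, Real.sqrt_mul (by positivity),
      Real.sqrt_sq (by norm_num)]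
  have hs2 : √(2 * (n : ℝ)) ^ 2 = 2 * n := Real.sq_sqrt (by positivity)
  have hs3 : √(n : ℝ) ^ 2 = n := Real.sq_sqrt (by positivity)
  have hpow : (((2 * n : ℕ) : ℝ) / Real.exp 1) ^ (2 * n) =
      4 ^ n * ((n : ℝ) / Real.exp 1) ^ n * ((n : ℝ) / Real.exp 1) ^ n := by
    rw [pow_mul, ← mul_pow, ← mul_pow]
    congr 1
    push_cast
    ring
  have hf : (0 : ℝ) < n.factorial := by exact_mod_cast n.factorial_pos
  have hpos : 0 < ((n : ℝ) / Real.exp 1) ^ n := by positivity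
  have hsq : 0 < √(n : ℝ) := Real.sqrt_pos.2 hn'
  rw [Stirling.stirlingSeq, Stirling.stirlingSeq, ← hfac', hs, hpow, returnProb]
  set y := ((n : ℝ) / Real.exp 1) ^ n
  rw [div_pow, mul_pow, hs2]
  set f := (n.factorial : ℝ)
  set r := √(n : ℝ)
  rw [← hs3]
  field_simp

lemma tendsto_returnProb_mul_sqrt :
    Tendsto (fun n : ℕ => returnProb n * √n) atTop (𝓝 (√Real.pi)⁻¹) := by
  have h := Stirling.tendsto_stirlingSeq_sqrt_pi
  have h2 := (h.comp (tendsto_atTop_mono (fun N : ℕ => (by omega : N ≤ 2 * N)) tendsto_id)).div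
    (h.pow 2) (by positivity)
  rw [show √Real.pi / √Real.pi ^ 2 = (√Real.pi)⁻¹ by field_simp] at h2
  refine h2.congr' ((eventually_ne_atTop 0).mono fun n hn => ?_)
  simp only [returnProb_mul_sqrt n hn, Pi.div_apply, Function.comp_apply]

lemma tendsto_natCast_succ_div : Tendsto (fun n : ℕ => ((n : ℝ) + 1) / n) atTop (𝓝 1) := by
  have h := (tendsto_inv_atTop_zero.comp (tendsto_natCast_atTop_atTop (R := ℝ))).const_add 1
  rw [add_zero] at h
  refine h.congr' ((eventually_gt_atTop 0).mono fun n hn => ?_)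
  have hn' : (0 : ℝ) < n := by exact_mod_cast hn
  simp only [Function.comp_apply]
  field_simp

lemma tendsto_returnProb_mul_sqrt_succ :
    Tendsto (fun n : ℕ => returnProb n * √(n + 1)) atTop (𝓝 (√Real.pi)⁻¹) := by
  have h := tendsto_returnProb_mul_sqrt.mul tendsto_natCast_succ_div.sqrt
  rw [Real.sqrt_one, mul_one] at h
  refine h.congr' ((eventually_gt_atTop 0).mono fun n hn => ?_)
  have hn' : (0 : ℝ) < n := by exact_mod_cast hn
  rw [mul_assoc, ← Real.sqrt_mul hn'.le]
  congr 2
  field_simp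

/-- This turns the factor `2 * M + 1` of the arc count, the number of cut points, into a partial
sum, so that the mean cost becomes a convolution. -/
lemma sum_returnProb (M : ℕ) :
    ∑ j ∈ Finset.range (M + 1), returnProb j = (2 * M + 1) * returnProb M := by
  induction M with
  | zero => simp
  | succ M ih =>
    rw [Finset.sum_range_succ, ih]
    have h : ((M : ℝ) + 1) * (M + 1).centralBinom = 2 * (2 * M + 1) * M.centralBinom := by
      exact_mod_cast Nat.succ_mul_centralBinom_succ M
    have h2 : 2 * ((M : ℝ) + 1) * returnProb (M + 1) = (2 * M + 1) * returnProb M := by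
      rw [returnProb, returnProb, pow_succ]
      field_simp
      linarith
    push_cast
    linarith

/-! ### Convolutions with regularly varying sequences -/

/-- Writing sums as integrals of step functions makes dominated convergence available for the
convolution. -/
lemma integral_floor (h : ℕ → ℝ) (N : ℕ) :
    ∫ y in (0 : ℝ)..N, h ⌊y⌋₊ = ∑ j ∈ Finset.range N, h j := by
  have hcongr : ∀ k : ℕ, ∀ᵐ y : ℝ, y ∈ Set.uIoc (k : ℝ) (k + 1 : ℕ) → h k = h ⌊y⌋₊ := by
    intro k
    have hne : ∀ᵐ y : ℝ, y ≠ (k + 1 : ℕ) := by simp [ae_iff]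
    filter_upwards [hne] with y hy hmem
    rw [Set.uIoc_of_le (by simp)] at hmem
    rw [(Nat.floor_eq_iff (k.cast_nonneg.trans hmem.1.le)).2
      ⟨hmem.1.le, lt_of_le_of_ne (by exact_mod_cast hmem.2) (by exact_mod_cast hy)⟩]
  have h1 := intervalIntegral.sum_integral_adjacent_intervals (f := fun y : ℝ => h ⌊y⌋₊)
    (μ := volume) (a := fun k : ℕ => (k : ℝ)) (n := N) fun k _ =>
      (intervalIntegrable_const (c := h k)).congr_ae
        ((ae_restrict_iff' measurableSet_uIoc).2 (hcongr k))
  rw [Nat.cast_zero] at h1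
  rw [← h1]
  refine Finset.sum_congr rfl fun k _ => ?_
  rw [← intervalIntegral.integral_congr_ae (hcongr k)]
  simp

lemma tendsto_floor_mul_div {x : ℝ} (hx : 0 ≤ x) :
    Tendsto (fun N : ℕ => (⌊(N : ℝ) * x⌋₊ : ℝ) / N) atTop (𝓝 x) := by
  have h := (tendsto_nat_floor_mul_div_atTop hx).comp (tendsto_natCast_atTop_atTop (R := ℝ))
  refine h.congr fun N => ?_
  simp [mul_comm]

lemma floor_mul_le {x : ℝ} (hx : x ≤ 1) (N : ℕ) : ⌊(N : ℝ) * x⌋₊ ≤ N :=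
  Nat.floor_le_of_le (mul_le_of_le_one_right N.cast_nonneg hx)

lemma tendsto_sub_floor_mul_div {x : ℝ} (hx : 0 ≤ x) (hx1 : x ≤ 1) :
    Tendsto (fun N : ℕ => ((N - ⌊(N : ℝ) * x⌋₊ : ℕ) : ℝ) / N) atTop (𝓝 (1 - x)) := by
  refine ((tendsto_floor_mul_div hx).const_sub 1).congr'
    ((eventually_gt_atTop 0).mono fun N hN => ?_)
  have hN' : (0 : ℝ) < N := by exact_mod_cast hN
  simp only
  rw [Nat.cast_sub (floor_mul_le hx1 N)]
  field_simp

lemma tendsto_atTop_of_tendsto_div {m : ℕ → ℕ} {y : ℝ} (hy : 0 < y)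
    (hm : Tendsto (fun N : ℕ => (m N : ℝ) / N) atTop (𝓝 y)) : Tendsto m atTop atTop := by
  rw [← tendsto_natCast_atTop_iff (R := ℝ)]
  refine (hm.pos_mul_atTop hy (tendsto_natCast_atTop_atTop (R := ℝ))).congr'
    ((eventually_gt_atTop 0).mono fun N hN => ?_)
  have hN' : (0 : ℝ) < N := by exact_mod_cast hN
  field_simp

/-- The sequence `L` is regularly varying of index `q`. -/
def RegularlyVarying (L : ℕ → ℝ) (q : ℝ) : Prop :=
  ∀ (m : ℕ → ℕ) (y : ℝ), 0 < y → Tendsto (fun N : ℕ => (m N : ℝ) / N) atTop (𝓝 y) →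
    Tendsto (fun N => L (m N) / L N) atTop (𝓝 (y ^ q))

lemma regularlyVarying_const : RegularlyVarying (fun _ => 1) 0 := by
  intro m y _ _
  simp

lemma regularlyVarying_rpow (q : ℝ) : RegularlyVarying (fun n => (n : ℝ) ^ q) q := by
  intro m y hy hm
  refine (hm.rpow_const (Or.inl hy.ne')).congr fun N => ?_
  rw [Real.div_rpow (m N).cast_nonneg N.cast_nonneg]

lemma tendsto_log_natCast : Tendsto (fun n : ℕ => Real.log n) atTop atTop :=
  Real.tendsto_log_atTop.comp (tendsto_natCast_atTop_atTop (R := ℝ))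

lemma regularlyVarying_log : RegularlyVarying (fun n => Real.log n) 0 := by
  intro m y hy hm
  have h := (((Real.continuousAt_log hy.ne').tendsto.comp hm).mul
    tendsto_log_natCast.inv_tendsto_atTop).const_add 1
  rw [mul_zero, add_zero] at h
  rw [Real.rpow_zero]
  have hm0 := tendsto_atTop_of_tendsto_div hy hm
  refine h.congr' ?_
  filter_upwards [eventually_gt_atTop 1, hm0.eventually_gt_atTop 0] with N hN hmN
  have hN' : (1 : ℝ) < N := by exact_mod_cast hN
  have hmN' : (0 : ℝ) < m N := by exact_mod_cast hmN
  have hlog := Real.log_pos hN'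
  simp only [Function.comp_apply, Pi.inv_apply]
  rw [Real.log_div hmN'.ne' (by linarith)]
  field_simp
  ring

lemma RegularlyVarying.of_tendsto_div {L S : ℕ → ℝ} {q c : ℝ} (hL : RegularlyVarying L q)
    (hc : c ≠ 0) (hS : Tendsto (fun n => S n / L n) atTop (𝓝 c)) : RegularlyVarying S q := by
  intro m y hy hm
  have hm0 := tendsto_atTop_of_tendsto_div hy hm
  have h := ((hS.comp hm0).div hS hc).mul (hL m y hy hm)
  rw [div_self hc, one_mul] at h
  refine h.congr' ?_
  have hne : ∀ᶠ n in atTop, S n / L n ≠ 0 := hS.eventually_ne hc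
  filter_upwards [hne, hm0.eventually hne] with N h1 h2
  have h3 : L N ≠ 0 := fun h => h1 (by simp [h])
  have h4 : L (m N) ≠ 0 := fun h => h2 (by simp [h])
  have h5 : S N ≠ 0 := fun h => h1 (by simp [h])
  simp only [Pi.div_apply, Function.comp_apply]
  field_simp

/-- A sequence equivalent to a multiple of `n ^ (-1/2)`, convolved with a monotone regularly
varying sequence. -/
lemma tendsto_convolution {b S : ℕ → ℝ} {β q : ℝ}
    (hb : Tendsto (fun n : ℕ => b n * √(n + 1)) atTop (𝓝 β)) (hmono : Monotone S)
    (hS0 : 0 ≤ S 0) (hpos : ∀ n, 0 < n → 0 < S n) (hS : RegularlyVarying S q) :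
    Tendsto (fun N : ℕ => (∑ j ∈ Finset.range N, b j * S (N - j)) / (√N * S N)) atTop
      (𝓝 (∫ x in (0 : ℝ)..1, β * x ^ (-(1 / 2) : ℝ) * (1 - x) ^ q)) := by
  obtain ⟨C, hC⟩ : ∃ C, ∀ n : ℕ, |b n * √(n + 1)| ≤ C := by
    obtain ⟨C, hC⟩ := hb.abs.bddAbove_range
    exact ⟨C, fun n => hC ⟨n, rfl⟩⟩
  have hnonneg : ∀ n, 0 ≤ S n := fun n => hS0.trans (hmono n.zero_le)
  -- The substitution `j = ⌊N * x⌋` makes the normalised convolution an integral over `[0, 1]`,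
  -- whose integrand converges pointwise for `0 < x < 1`.
  set F : ℕ → ℝ → ℝ := fun N x =>
    √N * (b ⌊(N : ℝ) * x⌋₊ * S (N - ⌊(N : ℝ) * x⌋₊)) / S N with hF
  have heq : ∀ N : ℕ, 0 < N → ∫ x in (0 : ℝ)..1, F N x =
      (∑ j ∈ Finset.range N, b j * S (N - j)) / (√N * S N) := by
    intro N hN
    have hN' : (0 : ℝ) < N := by exact_mod_cast hN
    have h1 := intervalIntegral.integral_comp_mul_left (a := 0) (b := 1)
      (fun y : ℝ => b ⌊y⌋₊ * S (N - ⌊y⌋₊)) hN'.ne'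
    rw [mul_zero, mul_one, integral_floor fun j => b j * S (N - j)] at h1
    simp only [hF]
    rw [intervalIntegral.integral_div, intervalIntegral.integral_const_mul, h1, smul_eq_mul]
    have hsq : √(N : ℝ) * √(N : ℝ) = N := Real.mul_self_sqrt hN'.le
    have hsq0 : 0 < √(N : ℝ) := Real.sqrt_pos.2 hN'
    have hSN := hpos N hN
    nth_rewrite 2 [← hsq]
    field_simp
  refine Tendsto.congr' ((eventually_gt_atTop 0).mono heq) ?_
  refine intervalIntegral.tendsto_integral_filter_of_dominated_convergence
    (fun x => C * x ^ (-(1 / 2) : ℝ)) ?_ ?_ ?_ ?_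
  · refine Eventually.of_forall fun N => Measurable.aestronglyMeasurable ?_
    have hfl : Measurable fun x : ℝ => ⌊(N : ℝ) * x⌋₊ := Nat.measurable_floor.comp (by fun_prop)
    refine (Measurable.const_mul (Measurable.mul ?_ ?_) _).div_const _
    · exact (measurable_from_nat (f := b)).comp hfl
    · exact (measurable_from_nat (f := fun j => S (N - j))).comp hfl
  · filter_upwards [eventually_gt_atTop 0] with N hN
    refine Eventually.of_forall fun x hx => ?_
    rw [Set.uIoc_of_le zero_le_one] at hx
    have hN' : (0 : ℝ) < N := by exact_mod_cast hN
    have hSN := hpos N hN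
    have hsx : 0 < √x := Real.sqrt_pos.2 hx.1
    have hxr : x ^ (-(1 / 2) : ℝ) = (√x)⁻¹ := by
      rw [Real.rpow_neg hx.1.le, ← Real.sqrt_eq_rpow]
    have h1 := hC ⌊(N : ℝ) * x⌋₊
    rw [abs_mul, abs_of_nonneg (Real.sqrt_nonneg _)] at h1
    -- Normalising `b n` by `√(n + 1)` rather than `√n` makes this bound valid also where the floor
    -- is zero; with `S (N - j) ≤ S N` it yields the integrable majorant `C / √x`.
    have h2 : √(N : ℝ) * √x ≤ √((⌊(N : ℝ) * x⌋₊ : ℝ) + 1) := by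
      rw [← Real.sqrt_mul hN'.le]
      exact Real.sqrt_le_sqrt (Nat.lt_floor_add_one _).le
    have h3 : S (N - ⌊(N : ℝ) * x⌋₊) / S N ≤ 1 :=
      (div_le_one hSN).2 (hmono (Nat.sub_le _ _))
    rw [hxr, ← div_eq_mul_inv, le_div_iff₀ hsx, Real.norm_eq_abs]
    simp only [hF]
    rw [abs_div, abs_mul, abs_mul, abs_of_nonneg (Real.sqrt_nonneg _), abs_of_nonneg (hnonneg _),
      abs_of_pos hSN]
    calc √(N : ℝ) * (|b ⌊(N : ℝ) * x⌋₊| * S (N - ⌊(N : ℝ) * x⌋₊)) / S N * √x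
        = |b ⌊(N : ℝ) * x⌋₊| * (√(N : ℝ) * √x) * (S (N - ⌊(N : ℝ) * x⌋₊) / S N) := by ring
      _ ≤ |b ⌊(N : ℝ) * x⌋₊| * √((⌊(N : ℝ) * x⌋₊ : ℝ) + 1) * 1 := by
        have := div_nonneg (hnonneg (N - ⌊(N : ℝ) * x⌋₊)) hSN.le
        gcongr
      _ ≤ C := by rwa [mul_one]
  · exact (intervalIntegral.intervalIntegrable_rpow' (by norm_num)).const_mul _
  · have hne : ∀ᵐ x : ℝ, x ≠ 1 := by simp [ae_iff]
    filter_upwards [hne] with x hx1 hx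
    rw [Set.uIoc_of_le zero_le_one] at hx
    have hx2 : 0 < 1 - x := sub_pos.2 (lt_of_le_of_ne hx.2 hx1)
    have hfl := tendsto_floor_mul_div hx.1.le
    have h1 := hb.comp (tendsto_atTop_of_tendsto_div hx.1 hfl)
    have h2 := hS _ _ hx2 (tendsto_sub_floor_mul_div hx.1.le hx.2)
    have h3 := (((hfl.add tendsto_one_div_atTop_nhds_zero_nat).inv₀
      (by rw [add_zero]; exact hx.1.ne')).sqrt)
    rw [add_zero] at h3
    have h4 := (h1.mul h3).mul h2
    have hxr : x ^ (-(1 / 2) : ℝ) = √x⁻¹ := by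
      rw [Real.rpow_neg hx.1.le, ← Real.sqrt_eq_rpow, Real.sqrt_inv]
    rw [hxr]
    refine h4.congr' ((eventually_gt_atTop 0).mono fun N hN => ?_)
    have hN' : (0 : ℝ) < N := by exact_mod_cast hN
    simp only [Function.comp_apply, hF]
    rw [← add_div, inv_div, Real.sqrt_div hN'.le]
    have h5 : 0 < √((⌊(N : ℝ) * x⌋₊ : ℝ) + 1) := Real.sqrt_pos.2 (by positivity)
    have h6 := hpos N hN
    field_simp

lemma integral_beta_pos {β q : ℝ} (hβ : 0 < β) (hq : 0 ≤ q) :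
    0 < ∫ x in (0 : ℝ)..1, β * x ^ (-(1 / 2) : ℝ) * (1 - x) ^ q := by
  refine intervalIntegral.intervalIntegral_pos_of_pos_on ?_ ?_ one_pos
  · refine ((intervalIntegral.intervalIntegrable_rpow' (by norm_num)).const_mul β).mul_continuousOn ?_
    exact ((continuous_const.sub continuous_id).rpow_const fun _ => Or.inr hq).continuousOn
  · intro x hx
    have h1 : 0 < x ^ (-(1 / 2) : ℝ) := Real.rpow_pos_of_pos hx.1 _
    have h2 : 0 < (1 - x) ^ q := Real.rpow_pos_of_pos (sub_pos.2 hx.2) _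
    positivity

/-! ### Partial sums of power-like sequences -/

/-- A form of the Stolz–Cesàro theorem: the error `a k - c * (L (k + 1) - L k)` is negligible
against the increments of `L`, and this survives summation because the increments are positive with
divergent sum. -/
lemma tendsto_sum_div_of_increments {a L : ℕ → ℝ} {c : ℝ} (hL : StrictMono L)
    (hLtop : Tendsto L atTop atTop)
    (h : Tendsto (fun k => a k / (L (k + 1) - L k)) atTop (𝓝 c)) :
    Tendsto (fun n => (∑ k ∈ Finset.range n, a k) / L n) atTop (𝓝 c) := by
  have hinc : ∀ k, 0 < L (k + 1) - L k := fun k => sub_pos.2 (hL (Nat.lt_succ_self k))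
  have hsum : ∀ n, ∑ k ∈ Finset.range n, (L (k + 1) - L k) = L n - L 0 :=
    fun n => Finset.sum_range_sub L n
  have hdiff : Tendsto (fun n => L n - L 0) atTop atTop := tendsto_atTop_add_const_right _ _ hLtop
  have ho : (fun k => a k - c * (L (k + 1) - L k)) =o[atTop] fun k => L (k + 1) - L k := by
    rw [Asymptotics.isLittleO_iff_tendsto fun k hk => absurd hk (hinc k).ne']
    refine ((h.sub_const c).congr fun k => ?_).trans_eq (by rw [sub_self])
    have := (hinc k).ne'
    field_simp
  have h2 := ho.sum_range (fun k => (hinc k).le) (by simpa only [hsum] using hdiff)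
  have hsum' : ∀ n, ∑ k ∈ Finset.range n, (a k - c * (L (k + 1) - L k)) =
      ∑ k ∈ Finset.range n, a k - c * (L n - L 0) := by
    intro n
    rw [Finset.sum_sub_distrib, ← Finset.mul_sum, hsum]
  simp_rw [hsum', hsum] at h2
  have h3 := h2.tendsto_div_nhds_zero
  have hinv := hLtop.inv_tendsto_atTop
  have h4 : Tendsto (fun n => (L n - L 0) / L n) atTop (𝓝 1) := by
    have h5 := (hinv.const_mul (L 0)).const_sub 1
    rw [mul_zero, sub_zero] at h5
    refine h5.congr' ((hLtop.eventually_gt_atTop 0).mono fun n hn => ?_)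
    simp only [Pi.inv_apply]
    field_simp
  have h6 := (h3.add_const c).mul h4
  rw [zero_add, mul_one] at h6
  refine h6.congr' ?_
  filter_upwards [hLtop.eventually_gt_atTop 0, hdiff.eventually_gt_atTop 0] with n h7 h8
  have h9 := h8.ne'
  field_simp
  ring

lemma tendsto_sum_div_log {a : ℕ → ℝ} {A : ℝ}
    (ha : Tendsto (fun k : ℕ => a k * k) atTop (𝓝 A)) :
    Tendsto (fun n : ℕ => (∑ k ∈ Finset.range n, a k) / Real.log n) atTop (𝓝 A) := by
  -- The shift is needed because `Real.log 0 = Real.log 1 = 0`, so the unshifted sequence is not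
  -- strictly increasing.
  have hmono : StrictMono fun n : ℕ => Real.log (n + 1) := by
    intro m n hmn
    have : (m : ℝ) < n := by exact_mod_cast hmn
    exact Real.log_lt_log (by positivity) (by linarith)
  have htop : Tendsto (fun n : ℕ => Real.log (n + 1)) atTop atTop := by
    have h := tendsto_log_natCast.comp (tendsto_add_atTop_nat 1)
    simpa [Function.comp_def] using h
  have hlog : Tendsto (fun k : ℕ => (k : ℝ) * (Real.log ((k + 1 : ℕ) + 1) - Real.log (k + 1)))
      atTop (𝓝 1) := by
    have h := (Real.tendsto_mul_log_one_add_div_atTop 1).comp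
      ((tendsto_natCast_atTop_atTop (R := ℝ)).comp (tendsto_add_atTop_nat 1))
    have h2 := h.mul (tendsto_natCast_succ_div.inv₀ one_ne_zero)
    rw [inv_one, mul_one] at h2
    refine h2.congr' ((eventually_gt_atTop 0).mono fun k hk => ?_)
    have hk' : (0 : ℝ) < k := by exact_mod_cast hk
    simp only [Function.comp_apply]
    push_cast
    rw [← Real.log_div (by positivity) (by positivity), inv_div,
      show ((k : ℝ) + 1 + 1) / (k + 1) = 1 + 1 / (k + 1) by field_simp]
    field_simp
  have h1 := tendsto_sum_div_of_increments (a := a) hmono htop (c := A) (by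
    have h := ha.div hlog one_ne_zero
    rw [div_one] at h
    refine h.congr' ((eventually_gt_atTop 0).mono fun k hk => ?_)
    have hk' : (k : ℝ) ≠ 0 := by exact_mod_cast hk.ne'
    simp only [Pi.div_apply]
    rw [mul_comm, mul_div_mul_left _ _ hk'])
  have h2 : Tendsto (fun n : ℕ => Real.log (n + 1) / Real.log n) atTop (𝓝 1) := by
    have h := regularlyVarying_log (fun n => n + 1) 1 one_pos (by
      simpa using tendsto_natCast_succ_div)
    simpa using h
  have h3 := h1.mul h2
  rw [mul_one] at h3
  refine h3.congr' ((htop.eventually_gt_atTop 0).mono fun n hn => ?_)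
  simp only
  rw [div_mul_div_cancel₀ hn.ne']

lemma tendsto_sum_div_rpow {a : ℕ → ℝ} {A q : ℝ} (hq : 0 < q)
    (ha : Tendsto (fun k : ℕ => a k * (k : ℝ) ^ (1 - q)) atTop (𝓝 A)) :
    Tendsto (fun n : ℕ => (∑ k ∈ Finset.range n, a k) / (n : ℝ) ^ q) atTop (𝓝 (A / q)) := by
  refine tendsto_sum_div_of_increments (L := fun n : ℕ => (n : ℝ) ^ q) ?_ ?_ ?_
  · intro m n hmn
    exact Real.rpow_lt_rpow m.cast_nonneg (by exact_mod_cast hmn) hq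
  · exact (tendsto_rpow_atTop hq).comp (tendsto_natCast_atTop_atTop (R := ℝ))
  -- The increment `(k + 1) ^ q - k ^ q` is `k ^ (q - 1)` times the difference quotient of `x ^ q`
  -- at `1` with step `1 / k`, which tends to `q`.
  · have hd : HasDerivAt (fun x : ℝ => x ^ q) (q * 1 ^ (q - 1)) 1 :=
      Real.hasDerivAt_rpow_const (Or.inl one_ne_zero)
    rw [Real.one_rpow, mul_one] at hd
    have hslope := hd.tendsto_slope_zero_right.comp ((tendsto_nhdsWithin_iff (s := Set.Ioi (0 : ℝ))
      (f := fun k : ℕ => 1 / (k : ℝ))).2 ⟨tendsto_one_div_atTop_nhds_zero_nat,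
        (eventually_gt_atTop 0).mono fun k hk => by
          have hk' : (0 : ℝ) < k := by exact_mod_cast hk
          exact Set.mem_Ioi.2 (by positivity)⟩)
    refine (ha.div hslope hq.ne').congr' ((eventually_gt_atTop 0).mono fun k hk => ?_)
    have hk' : (0 : ℝ) < k := by exact_mod_cast hk
    simp only [Pi.div_apply, Function.comp_apply, smul_eq_mul, Real.one_rpow]
    have h1 : ((k + 1 : ℕ) : ℝ) ^ q = (k : ℝ) ^ q * (1 + 1 / (k : ℝ)) ^ q := by
      rw [← Real.mul_rpow hk'.le (by positivity)]
      congr 1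
      push_cast
      field_simp
    have h2 : (k : ℝ) ^ q = k / (k : ℝ) ^ (1 - q) := by
      rw [Real.rpow_sub hk', Real.rpow_one]
      field_simp
    have h3 : 0 < (k : ℝ) ^ (1 - q) := Real.rpow_pos_of_pos hk' _
    have h4 : (1 + 1 / (k : ℝ)) ^ q - 1 ≠ 0 := by
      have : 1 < (1 + 1 / (k : ℝ)) ^ q := Real.one_lt_rpow (by simp [hk']) hq
      linarith
    have h5 : ((k + 1 : ℕ) : ℝ) ^ q - (k : ℝ) ^ q =
        k / (k : ℝ) ^ (1 - q) * ((1 + 1 / (k : ℝ)) ^ q - 1) := by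
      rw [h1, ← h2]; ring
    rw [h5, one_div, inv_inv]
    rw [one_div] at h4
    field_simp

/-! ### The mean cost of the Dyck matching -/

/-- The weight of the arcs of length `2 * k + 1` when an arc of length `l` costs `φ l`. -/
noncomputable def arcWeight (φ : ℕ → ℝ) (k : ℕ) : ℝ := catalan k / 4 ^ k * φ (2 * k + 1)

lemma catalan_div_four_pow (k : ℕ) : (catalan k : ℝ) / 4 ^ k = returnProb k / (k + 1) := by
  have h : ((k : ℝ) + 1) * catalan k = k.centralBinom := by
    exact_mod_cast succ_mul_catalan_eq_centralBinom k
  rw [returnProb, ← h]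
  field_simp

lemma arcWeight_pos {φ : ℕ → ℝ} (hφ : ∀ l, 0 < l → 0 < φ l) (k : ℕ) : 0 < arcWeight φ k := by
  rw [arcWeight, catalan_div_four_pow]
  have h1 := returnProb_pos k
  have h2 := hφ (2 * k + 1) (Nat.succ_pos _)
  positivity

/-- The Catalan factor is `returnProb k / (k + 1)`, of order `k ^ (-3/2) / √π`, and the cost of an
arc of length `2 * k + 1` is equivalent to `(2 * k) ^ p`. -/
lemma tendsto_arcWeight {φ : ℕ → ℝ} {p : ℝ}
    (hφ : Tendsto (fun l : ℕ => φ l / (l : ℝ) ^ p) atTop (𝓝 1)) :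
    Tendsto (fun k : ℕ => arcWeight φ k * (k : ℝ) ^ (3 / 2 - p)) atTop
      (𝓝 ((√Real.pi)⁻¹ * 2 ^ p)) := by
  have h1 := hφ.comp (tendsto_atTop_mono (fun k : ℕ => (by omega : k ≤ 2 * k + 1)) tendsto_id)
  have h2 : Tendsto (fun k : ℕ => (((2 * k + 1 : ℕ) : ℝ) / k) ^ p) atTop (𝓝 (2 ^ p)) := by
    have h := tendsto_natCast_succ_div.add_const 1
    rw [one_add_one_eq_two] at h
    refine (h.rpow_const (p := p) (Or.inl two_ne_zero)).congr'
      ((eventually_gt_atTop 0).mono fun k hk => ?_)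
    have hk' : (0 : ℝ) < k := by exact_mod_cast hk
    congr 1
    push_cast
    field_simp
    ring
  have h3 := (tendsto_returnProb_mul_sqrt.mul (tendsto_natCast_succ_div.inv₀ one_ne_zero)).mul
    (h1.mul h2)
  rw [inv_one, mul_one, one_mul] at h3
  refine h3.congr' ((eventually_gt_atTop 0).mono fun k hk => ?_)
  have hk' : (0 : ℝ) < k := by exact_mod_cast hk
  have hl : (0 : ℝ) < ((2 * k + 1 : ℕ) : ℝ) := by positivity
  have h4 : (k : ℝ) ^ (3 / 2 - p) = k * √k / (k : ℝ) ^ p := by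
    rw [Real.rpow_sub hk', show (3 / 2 : ℝ) = 1 + 1 / 2 by norm_num, Real.rpow_add hk', Real.rpow_one,
      ← Real.sqrt_eq_rpow]
  have h5 : 0 < (((2 * k + 1 : ℕ) : ℝ)) ^ p := Real.rpow_pos_of_pos hl p
  have h6 : 0 < (k : ℝ) ^ p := Real.rpow_pos_of_pos hk' p
  simp only [Function.comp_apply]
  rw [arcWeight, catalan_div_four_pow, h4, Real.div_rpow hl.le hk'.le]
  field_simp

/-- With `M = N - 1 - k`, `sum_returnProb` rewrites the bracket as `4 ^ M` times one plus the sum of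
`returnProb j` over `j ≤ M`; exchanging the order of summation collects the arc weights into partial
sums. The quarter comes from `4 ^ k * 4 ^ M = 4 ^ N / 4`. -/
lemma sum_arcs_eq (φ : ℕ → ℝ) (N : ℕ) :
    ∑ k ∈ Finset.range N, (catalan k : ℝ) *
        ((2 * (N - 1 - k : ℕ) + 1) * (N - 1 - k).centralBinom + 4 ^ (N - 1 - k)) * φ (2 * k + 1) =
      4 ^ N / 4 * (∑ j ∈ Finset.range N, returnProb j * ∑ k ∈ Finset.range (N - j), arcWeight φ k +
        ∑ k ∈ Finset.range N, arcWeight φ k) := by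
  have h1 : ∑ j ∈ Finset.range N, returnProb j * ∑ k ∈ Finset.range (N - j), arcWeight φ k =
      ∑ k ∈ Finset.range N, arcWeight φ k * ∑ j ∈ Finset.range (N - k), returnProb j := by
    simp_rw [Finset.mul_sum]
    rw [Finset.sum_comm' (t' := Finset.range N) (s' := fun k => Finset.range (N - k))]
    · exact Finset.sum_congr rfl fun k _ => Finset.sum_congr rfl fun j _ => mul_comm _ _
    · intro j k
      simp only [Finset.mem_range]
      omega
  rw [h1, ← Finset.sum_add_distrib, Finset.mul_sum]
  refine Finset.sum_congr rfl fun k hk => ?_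
  have hk' := Finset.mem_range.1 hk
  obtain ⟨M, rfl⟩ : ∃ M, N = M + 1 + k := ⟨N - 1 - k, by omega⟩
  rw [show M + 1 + k - 1 - k = M by omega, Nat.add_sub_cancel, sum_returnProb, arcWeight, returnProb,
    pow_add, pow_succ]
  field_simp

/-- If the partial sums of the arc weights grow like `L`, the mean cost grows like `N * L N`. -/
lemma sameOrder_meanDyckCost {M : Model} {p : ℝ} {g φ L : ℕ → ℝ} {c q : ℝ}
    (hg : Tendsto g atTop (𝓝 1)) (hφ : ∀ l, 0 < l → 0 < φ l)
    (hint : ∀ (N : ℕ) (i j : Fin (2 * N)), i < j →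
      Integrable (fun s => |position s i - position s j| ^ p) (spacingLaw M N) ∧
      ∫ s, |position s i - position s j| ^ p ∂(spacingLaw M N) = g N * φ (j - i))
    (hq : 0 ≤ q) (hL : RegularlyVarying L q) (hc : c ≠ 0)
    (hS : Tendsto (fun n => (∑ k ∈ Finset.range n, arcWeight φ k) / L n) atTop (𝓝 c)) :
    SameOrder (meanDyckCost M p) (fun N => N * L N) := by
  set S : ℕ → ℝ := fun n => ∑ k ∈ Finset.range n, arcWeight φ k with hSdef
  have hpos : ∀ n, 0 < n → 0 < S n := fun n hn =>
    Finset.sum_pos (fun k _ => arcWeight_pos hφ k) (Finset.nonempty_range_iff.2 hn.ne')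
  have hmono : Monotone S := monotone_nat_of_le_succ fun n => by
    simp only [hSdef, Finset.sum_range_succ]
    linarith [arcWeight_pos hφ n]
  have hπ : 0 < (√Real.pi)⁻¹ := by positivity
  have hconv := tendsto_convolution tendsto_returnProb_mul_sqrt_succ hmono (by simp [hSdef]) hpos
    (hL.of_tendsto_div hc hS)
  have hI := integral_beta_pos hπ hq
  set I := ∫ x in (0 : ℝ)..1, (√Real.pi)⁻¹ * x ^ (-(1 / 2) : ℝ) * (1 - x) ^ q
  have hsqrt : Tendsto (fun N : ℕ => (√(N : ℝ))⁻¹) atTop (𝓝 0) :=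
    (Real.tendsto_sqrt_atTop.comp (tendsto_natCast_atTop_atTop (R := ℝ))).inv_tendsto_atTop
  have hmean : ∀ N, meanDyckCost M p N = g N * (4 * returnProb N)⁻¹ *
      (∑ j ∈ Finset.range N, returnProb j * S (N - j) + S N) := by
    intro N
    have h := sum_integral_cost (f := fun l => g N * φ l) (fun i j hij => (hint N i j hij).1)
      (fun i j hij => (hint N i j hij).2)
    have h4 : (N.centralBinom : ℝ) ≠ 0 := by exact_mod_cast N.centralBinom_ne_zero
    rw [meanDyckCost, h, card_bridge]
    simp_rw [mul_left_comm _ (g N)]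
    rw [← Finset.mul_sum, sum_arcs_eq, returnProb]
    field_simp
    rfl
  -- The factors are the limits of `g N`, of `(4 * returnProb N * √N)⁻¹`, of the convolution divided
  -- by `√N * S N`, of the extra term `S N` divided by `√N * S N`, and of `S N / L N`.
  refine ⟨1 * (4 * (√Real.pi)⁻¹)⁻¹ * (I + 0) * c, ?_, ?_⟩
  · have := hI.ne'
    simp only [add_zero]
    positivity
  · have h := ((hg.mul ((tendsto_returnProb_mul_sqrt.const_mul 4).inv₀ (by positivity))).mul
      (hconv.add hsqrt)).mul hS
    refine h.congr' ?_
    filter_upwards [eventually_gt_atTop 0, hS.eventually_ne hc] with N hN hSL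
    have hN' : (0 : ℝ) < N := by exact_mod_cast hN
    have hLN : L N ≠ 0 := fun h => hSL (by simp [h])
    have hSN := hpos N hN
    have hr := returnProb_pos N
    have hsq0 : 0 < √(N : ℝ) := Real.sqrt_pos.2 hN'
    have hsq : √(N : ℝ) ^ 2 = N := Real.sq_sqrt hN'.le
    change _ * _ * _ * (S N / L N) = _
    rw [hmean]
    rw [show (N : ℝ) * L N = √(N : ℝ) ^ 2 * L N by rw [hsq]]
    field_simp

end DyckAssignment

theorem theorem1 (M : DyckAssignment.Model) (p : ℝ) (hp0 : 0 ≤ p) (hp1 : p ≤ 1) :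
    (∀ (N : ℕ) (σ : DyckAssignment.Bridge N),
      Integrable (fun s => DyckAssignment.cost p s (DyckAssignment.dyckMatching σ))
        (DyckAssignment.spacingLaw M N)) ∧
    (p < 1 / 2 →
      DyckAssignment.SameOrder (DyckAssignment.meanDyckCost M p) (fun N => (N : ℝ))) ∧
    (p = 1 / 2 →
      DyckAssignment.SameOrder (DyckAssignment.meanDyckCost M p)
        (fun N => (N : ℝ) * Real.log N)) ∧
    (1 / 2 < p →
      DyckAssignment.SameOrder (DyckAssignment.meanDyckCost M p)
        (fun N => (N : ℝ) ^ (1 / 2 + p))) := by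
  obtain ⟨g, φ, hg, hφ, hφp, hint⟩ := DyckAssignment.exists_arc_moments M hp0 hp1
  have hA := DyckAssignment.tendsto_arcWeight hφp
  have hA0 : (√Real.pi)⁻¹ * 2 ^ p ≠ 0 := by positivity
  have hw := DyckAssignment.arcWeight_pos hφ
  refine ⟨fun N σ => DyckAssignment.integrable_cost (fun i j hij => (hint N i j hij).1) σ, fun hp => ?_,
    fun hp => ?_, fun hp => ?_⟩
  -- Here the decay exponent `3 / 2 - p` exceeds one, so the partial sums converge to a positive
  -- total and the constant sequence serves as `L`.
  · have hsum : Summable (DyckAssignment.arcWeight φ) := by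
      have hO : DyckAssignment.arcWeight φ =O[atTop] fun k : ℕ => (k : ℝ) ^ (-(3 / 2 - p)) := by
        refine Asymptotics.isBigO_of_div_tendsto_nhds
          ((eventually_gt_atTop 0).mono fun k hk h => ?_) _ (hA.congr fun k => ?_)
        · have hk' : (0 : ℝ) < k := by exact_mod_cast hk
          exact absurd h (Real.rpow_pos_of_pos hk' _).ne'
        · rw [Pi.div_apply, Real.rpow_neg k.cast_nonneg, div_inv_eq_mul]
      exact summable_of_isBigO_nat (Real.summable_nat_rpow.2 (by linarith)) hO
    have hlim := hsum.hasSum.tendsto_sum_nat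
    have h := DyckAssignment.sameOrder_meanDyckCost hg hφ hint le_rfl
      DyckAssignment.regularlyVarying_const (hsum.tsum_pos (fun k => (hw k).le) 0 (hw 0)).ne'
      (by simpa using hlim)
    simpa using h
  -- At `p = 1 / 2` the weights are of order `1 / k`, and their partial sums grow logarithmically.
  · subst hp
    refine DyckAssignment.sameOrder_meanDyckCost hg hφ hint le_rfl
      DyckAssignment.regularlyVarying_log hA0 (DyckAssignment.tendsto_sum_div_log (hA.congr fun k => ?_))
    norm_num
  -- The weights are of order `k ^ (q - 1)` with `q = p - 1 / 2`, so `L N = N ^ q` and `N * L N = N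
  -- ^ (1 / 2 + p)`.
  · have hq : 0 < p - 1 / 2 := by linarith
    have h := DyckAssignment.sameOrder_meanDyckCost hg hφ hint hq.le
      (DyckAssignment.regularlyVarying_rpow (p - 1 / 2)) (div_ne_zero hA0 hq.ne')
      (DyckAssignment.tendsto_sum_div_rpow hq (hA.congr fun k => by ring_nf))
    obtain ⟨c, hc, hlim⟩ := h
    refine ⟨c, hc, hlim.congr' ((eventually_gt_atTop 0).mono fun N hN => ?_)⟩
    have hN' : (0 : ℝ) < N := by exact_mod_cast hN
    simp only
    rw [show 1 / 2 + p = 1 + (p - 1 / 2) by ring, Real.rpow_add hN', Real.rpow_one]
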